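/- Let $\Lambda$ be an artin algebra (an algebra, finitely generated as a module, over a commutative artinian ring), let $\mathrm{mod}\text{-}\Lambda$ be the category of finitely generated right $\Lambda$-modules, let $X\in\mathrm{mod}\text{-}\Lambda$, and let $\mathcal X=\mathrm{add}(X)$ be the full subcategory of all direct summands of finite direct sums of copies of $X$. Assume that $\mathcal X$ is contravariantly finite in $\mathrm{mod}\text{-}\Lambda$ (every $M\in\mathrm{mod}\text{-}\Lambda$ admits a morphism $Y\to M$ with $Y\in\mathcal X$ through which every morphism $Z\to M$ with $Z\in\mathcal X$ factors), that $\mathcal X$ contains all finitely generated projective modules, and that $\mathcal X\subseteq{}^{\perp}\Lambda=\{M:\mathrm{Ext}^i_\Lambda(M,\Lambda)=0\text{ for all }i>0\}$. Let $\mathrm{mod}\text{-}\mathcal X$ be the abelian category of finitely presented contravariant functors $F$ from $\mathcal X$ to abelian groups (those admitting an exact sequence $\mathcal X(-,X_1)\to\mathcal X(-,X_0)\to F\to0$ with $X_0,X_1\in\mathcal X$), and let $\mathrm{mod}_0\text{-}\mathcal X$ be its full subcategory of functors vanishing at $\Lambda$. The functor $\vartheta:\mathrm{mod}\text{-}\mathcal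 X\to\mathrm{mod}\text{-}\Lambda$ sends $F$ with a presentation $\mathcal X(-,X_1)\xrightarrow{(-,d)}\mathcal X(-,X_0)\to F\to0$ to $\mathrm{Coker}(d)$. It has a left adjoint $\vartheta_\lambda$, sending $M$ with a projective presentation $P\to Q\to M\to0$ to $\mathrm{Coker}(\mathcal X(-,P)\to\mathcal X(-,Q))$, and a right adjoint $\vartheta_\rho(M)=\mathrm{Hom}_\Lambda(-,M)|_{\mathcal X}$; both adjoints are fully faithful and these functors form a recollement of $\mathrm{mod}\text{-}\mathcal X$ by $\mathrm{mod}_0\text{-}\mathcal X$ and $\mathrm{mod}\text{-}\Lambda$. Let $\gamma:\vartheta_\lambda\to\vartheta_\rho$ be the natural transformation whose component $\gamma_M$ corresponds, under $\mathrm{Hom}(\vartheta_\lambda M,\vartheta_\rho M)\cong\mathrm{Hom}(M,\vartheta\vartheta_\rho M)$, to the inverse of the counit $\vartheta\vartheta_\rho M\to M$, and let $\zeta^{\mathcal X}_M=\mathrm{Im}(\gamma_M)$ (the intermediate extension functor). Put $\Gamma=\mathrm{End}_\Lambda(X)$ and let $T=\zeta^{\mathcal X}_X(X)$ be the value of the functor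 $\zeta^{\mathcal X}_X$ at $X$, a right $\Gamma$-module via $t\cdot f=\zeta^{\mathcal X}_X(f)(t)$. Call a finitely generated right $\Gamma$-module $T$ tilting (resp. cotilting) if its projective (resp. injective) dimension is at most $1$, $\mathrm{Ext}^1_\Gamma(T,T)=0$, and the number of isomorphism classes of indecomposable direct summands of $T$ equals the number of isomorphism classes of indecomposable direct summands of the right $\Gamma$-module $\Gamma$. Call $\mathcal X$ closed under syzygies if for every short exact sequence $0\to K\to P\to M\to0$ in $\mathrm{mod}\text{-}\Lambda$ with $P$ projective and $M\in\mathcal X$ one has $K\in\mathcal X$. (i) If $\mathcal X$ is closed under syzygies, then $T$ is a tilting $\Gamma$-module. (ii) If, furthermore, $\mathcal X$ is closed under submodules, then $T$ is also a cotilting $\Gamma$-module. -/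

import Mathlib

open CategoryTheory CategoryTheory.Limits Opposite

set_option linter.unusedSectionVars false

universe w v v₁ v₂ v₃ u u₁ u₂ u₃

namespace RelAus

noncomputable section

/-- A recollement of `A` by `A'` and `A''`: additive functors `ℓ : A' ⥤ A` and `ϑ : A ⥤ A''`, a left
adjoint `ℓl` and a right adjoint `ℓr` of `ℓ`, a left adjoint `ϑl` and a right adjoint `ϑr` of `ϑ`,
such that `ℓ`, `ϑl`, `ϑr` are fully faithful and the essential image of `ℓ` is the kernel of `ϑ`. -/
structure Recollement (A' : Type u₁) [Category.{v₁} A'] [Preadditive A']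
    (A : Type u₂) [Category.{v₂} A] [Preadditive A]
    (A'' : Type u₃) [Category.{v₃} A''] [Preadditive A''] where
  ℓ : A' ⥤ A
  ℓl : A ⥤ A'
  ℓr : A ⥤ A'
  ϑ : A ⥤ A''
  ϑl : A'' ⥤ A
  ϑr : A'' ⥤ A
  additive : ℓ.Additive ∧ ℓl.Additive ∧ ℓr.Additive ∧ ϑ.Additive ∧ ϑl.Additive ∧ ϑr.Additive
  ℓlAdj : ℓl ⊣ ℓ
  ℓrAdj : ℓ ⊣ ℓr
  ϑlAdj : ϑl ⊣ ϑ
  ϑrAdj : ϑ ⊣ ϑr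
  full_ℓ : ℓ.Full
  faithful_ℓ : ℓ.Faithful
  full_ϑl : ϑl.Full
  faithful_ϑl : ϑl.Faithful
  full_ϑr : ϑr.Full
  faithful_ϑr : ϑr.Faithful
  essImage_ℓ : ∀ a : A, ℓ.essImage a ↔ IsZero (ϑ.obj a)

namespace Recollement

variable {A' : Type u₁} [Category.{v₁} A'] [Preadditive A']
    {A : Type u₂} [Category.{v₂} A] [Preadditive A]
    {A'' : Type u₃} [Category.{v₃} A''] [Preadditive A''] (R : Recollement A' A A'')

instance : R.ϑr.Full := R.full_ϑr
instance : R.ϑr.Faithful := R.faithful_ϑr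

/-- The natural transformation `ϑl ⟶ ϑr` whose component at `M` corresponds, under the
adjunction `Hom(ϑl M, ϑr M) ≃ Hom(M, ϑ (ϑr M))`, to the inverse of the counit. -/
def γ : R.ϑl ⟶ R.ϑr where
  app M := (R.ϑlAdj.homEquiv M (R.ϑr.obj M)).symm (inv (R.ϑrAdj.counit.app M))
  naturality M N f := by
    rw [← Adjunction.homEquiv_naturality_left_symm, ← Adjunction.homEquiv_naturality_right_symm]
    congr 1
    rw [IsIso.eq_inv_comp, ← Category.assoc, IsIso.comp_inv_eq]
    exact (R.ϑrAdj.counit.naturality f).symm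

/-- The functor sending `M` to the morphism `γ M : ϑl M ⟶ ϑr M`. -/
def γArrow : A'' ⥤ Arrow A where
  obj M := Arrow.mk (R.γ.app M)
  map f := Arrow.homMk (R.ϑl.map f) (R.ϑr.map f)

/-- The intermediate extension functor: `ζ M` is the image of `γ M : ϑl M ⟶ ϑr M`. -/
def ζ [HasImages A] [HasImageMaps A] : A'' ⥤ A := R.γArrow ⋙ im

end Recollement

section OfTriple

variable {A : Type u₂} [Category.{v₂} A] [Abelian A]
    {A'' : Type u₃} [Category.{v₃} A''] [Abelian A'']
    {ϑ : A ⥤ A''} {ϑl ϑr : A'' ⥤ A}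

lemma hom_to_ϑr_eq_zero (adjr : ϑ ⊣ ϑr) {k : A} (hk : IsZero (ϑ.obj k)) {b : A''}
    (f : k ⟶ ϑr.obj b) : f = 0 :=
  (adjr.homEquiv _ _).symm.injective (hk.eq_of_src _ _)

lemma hom_from_ϑl_eq_zero (adjl : ϑl ⊣ ϑ) {k : A} (hk : IsZero (ϑ.obj k)) {b : A''}
    (f : ϑl.obj b ⟶ k) : f = 0 :=
  (adjl.homEquiv _ _).injective (hk.eq_of_tgt _ _)

lemma isZero_kernel_unit (adjl : ϑl ⊣ ϑ) (adjr : ϑ ⊣ ϑr) [ϑr.Full] [ϑr.Faithful] [ϑ.Additive]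
    (a : A) : IsZero (ϑ.obj (kernel (adjr.unit.app a))) := by
  have := Functor.preservesMonomorphisms_of_adjunction adjl
  have h : ϑ.map (kernel.ι (adjr.unit.app a)) = 0 := by
    rw [← cancel_mono (ϑ.map (adjr.unit.app a)), ← ϑ.map_comp, kernel.condition]
    simp
  rw [IsZero.iff_id_eq_zero, ← cancel_mono (ϑ.map (kernel.ι (adjr.unit.app a)))]
  simp [h]

lemma isZero_cokernel_counit (adjl : ϑl ⊣ ϑ) (adjr : ϑ ⊣ ϑr) [ϑl.Full] [ϑl.Faithful] [ϑ.Additive]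
    (a : A) : IsZero (ϑ.obj (cokernel (adjl.counit.app a))) := by
  have := Functor.preservesEpimorphisms_of_adjunction adjr
  have h : ϑ.map (cokernel.π (adjl.counit.app a)) = 0 := by
    rw [← cancel_epi (ϑ.map (adjl.counit.app a)), ← ϑ.map_comp, cokernel.condition]
    simp
  rw [IsZero.iff_id_eq_zero, ← cancel_epi (ϑ.map (cokernel.π (adjl.counit.app a)))]
  simp [h]

/-- Morphisms from the kernel of `ϑ` to `a` factor uniquely through the kernel of
`a ⟶ ϑr (ϑ a)`. -/
def kernelUnitEquiv (adjr : ϑ ⊣ ϑr) {P : ObjectProperty A} (hP : ∀ a, P a ↔ IsZero (ϑ.obj a))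
    (hker : ∀ a, P (kernel (adjr.unit.app a))) (k : P.FullSubcategory) (a : A) :
    (P.ι.obj k ⟶ a) ≃ (k ⟶ (⟨kernel (adjr.unit.app a), hker a⟩ : P.FullSubcategory)) where
  toFun f := ObjectProperty.homMk
    (kernel.lift _ f (hom_to_ϑr_eq_zero adjr ((hP _).1 k.property) _))
  invFun g := g.hom ≫ kernel.ι _
  left_inv f := by simp
  right_inv g := by
    apply ObjectProperty.hom_ext
    apply (cancel_mono (kernel.ι (adjr.unit.app a))).1
    simp

/-- Morphisms from `a` to the kernel of `ϑ` factor uniquely through the cokernel of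
`ϑl (ϑ a) ⟶ a`. -/
def cokernelCounitEquiv (adjl : ϑl ⊣ ϑ) {P : ObjectProperty A} (hP : ∀ a, P a ↔ IsZero (ϑ.obj a))
    (hcok : ∀ a, P (cokernel (adjl.counit.app a))) (a : A) (k : P.FullSubcategory) :
    ((⟨cokernel (adjl.counit.app a), hcok a⟩ : P.FullSubcategory) ⟶ k) ≃ (a ⟶ P.ι.obj k) where
  toFun g := cokernel.π _ ≫ g.hom
  invFun f := ObjectProperty.homMk
    (cokernel.desc _ f (hom_from_ϑl_eq_zero adjl ((hP _).1 k.property) _))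
  left_inv g := by
    apply ObjectProperty.hom_ext
    apply (cancel_epi (cokernel.π (adjl.counit.app a))).1
    simp
  right_inv f := by simp

lemma kernelUnitEquiv_naturality (adjr : ϑ ⊣ ϑr) {P : ObjectProperty A}
    (hP : ∀ a, P a ↔ IsZero (ϑ.obj a)) (hker : ∀ a, P (kernel (adjr.unit.app a)))
    (k' k : P.FullSubcategory) (a : A) (f : k' ⟶ k) (g : P.ι.obj k ⟶ a) :
    kernelUnitEquiv adjr hP hker k' a (P.ι.map f ≫ g) =
      f ≫ kernelUnitEquiv adjr hP hker k a g := by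
  apply ObjectProperty.hom_ext
  apply (cancel_mono (kernel.ι (adjr.unit.app a))).1
  simp [kernelUnitEquiv]

lemma cokernelCounitEquiv_naturality (adjl : ϑl ⊣ ϑ) {P : ObjectProperty A}
    (hP : ∀ a, P a ↔ IsZero (ϑ.obj a)) (hcok : ∀ a, P (cokernel (adjl.counit.app a)))
    (a : A) (k k' : P.FullSubcategory) (g : k ⟶ k')
    (h : (⟨cokernel (adjl.counit.app a), hcok a⟩ : P.FullSubcategory) ⟶ k) :
    cokernelCounitEquiv adjl hP hcok a k' (h ≫ g) =
      cokernelCounitEquiv adjl hP hcok a k h ≫ P.ι.map g := by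
  simp [cokernelCounitEquiv]

lemma full_faithful_left (adjl : ϑl ⊣ ϑ) (adjr : ϑ ⊣ ϑr) [ϑr.Full] [ϑr.Faithful] :
    ϑl.Full ∧ ϑl.Faithful :=
  have h := (Adjunction.Triple.mk adjl adjr).fullyFaithfulEquiv.symm
    (Functor.FullyFaithful.ofFullyFaithful ϑr)
  ⟨h.full, h.faithful⟩

lemma additive_middle (adjr : ϑ ⊣ ϑr) [ϑr.Additive] : ϑ.Additive := adjr.left_adjoint_additive

lemma prop_kernel_unit (adjl : ϑl ⊣ ϑ) (adjr : ϑ ⊣ ϑr) [ϑr.Full] [ϑr.Faithful] [ϑr.Additive]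
    {P : ObjectProperty A} (hP : ∀ a, P a ↔ IsZero (ϑ.obj a)) (a : A) :
    P (kernel (adjr.unit.app a)) :=
  have := additive_middle adjr
  (hP _).2 (isZero_kernel_unit adjl adjr a)

lemma prop_cokernel_counit (adjl : ϑl ⊣ ϑ) (adjr : ϑ ⊣ ϑr) [ϑr.Full] [ϑr.Faithful] [ϑr.Additive]
    {P : ObjectProperty A} (hP : ∀ a, P a ↔ IsZero (ϑ.obj a)) (a : A) :
    P (cokernel (adjl.counit.app a)) :=
  have := additive_middle adjr
  have := (full_faithful_left adjl adjr).1
  have := (full_faithful_left adjl adjr).2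
  (hP _).2 (isZero_cokernel_counit adjl adjr a)

/-- An adjoint triple `ϑl ⊣ ϑ ⊣ ϑr` between abelian categories with `ϑr` fully faithful, together
with the kernel `P` of `ϑ`, is a recollement: the adjoints of the inclusion of `P` send `a` to the
cokernel of `ϑl (ϑ a) ⟶ a` and to the kernel of `a ⟶ ϑr (ϑ a)`. -/
def Recollement.ofTriple (adjl : ϑl ⊣ ϑ) (adjr : ϑ ⊣ ϑr) [ϑr.Full] [ϑr.Faithful] [ϑr.Additive]
    {P : ObjectProperty A} (hP : ∀ a, P a ↔ IsZero (ϑ.obj a)) :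
    Recollement P.FullSubcategory A A'' where
  ℓ := P.ι
  ℓl := Adjunction.leftAdjointOfEquiv
    (cokernelCounitEquiv adjl hP (prop_cokernel_counit adjl adjr hP))
    (cokernelCounitEquiv_naturality adjl hP _)
  ℓr := Adjunction.rightAdjointOfEquiv
    (kernelUnitEquiv adjr hP (prop_kernel_unit adjl adjr hP))
    (kernelUnitEquiv_naturality adjr hP _)
  ϑ := ϑ
  ϑl := ϑl
  ϑr := ϑr
  additive :=
    have := additive_middle adjr
    ⟨inferInstance, (Adjunction.adjunctionOfEquivLeft _ _).left_adjoint_additive,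
      (Adjunction.adjunctionOfEquivRight _ _).right_adjoint_additive, inferInstance,
      adjl.left_adjoint_additive, inferInstance⟩
  ℓlAdj := Adjunction.adjunctionOfEquivLeft _ _
  ℓrAdj := Adjunction.adjunctionOfEquivRight _ _
  ϑlAdj := adjl
  ϑrAdj := adjr
  full_ℓ := inferInstance
  faithful_ℓ := inferInstance
  full_ϑl := (full_faithful_left adjl adjr).1
  faithful_ϑl := (full_faithful_left adjl adjr).2
  full_ϑr := inferInstance
  faithful_ϑr := inferInstance
  essImage_ℓ a := ⟨fun ⟨k, ⟨e⟩⟩ => ((hP _).1 k.property).of_iso (ϑ.mapIso e.symm),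
    fun h => ⟨⟨a, (hP a).2 h⟩, ⟨Iso.refl _⟩⟩⟩

end OfTriple

section FinitelyPresented

open scoped ZeroObject

variable {A : Type u} [Category.{v} A] [Preadditive A]

/-- A presentation `A(-, X₁) ⟶ A(-, X₀) ⟶ F ⟶ 0` of a contravariant functor `F : A ⥤ Ab`
(exactness of a sequence of functors means exactness at every object). -/
structure Presentation (F : Aᵒᵖ ⥤ AddCommGrpCat.{v}) where
  X₁ : A
  X₀ : A
  d : X₁ ⟶ X₀
  p : preadditiveYoneda.obj X₀ ⟶ F
  exact : ∀ Y, Function.Exact ((preadditiveYoneda.map d).app Y) (p.app Y)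
  surjective : ∀ Y, Function.Surjective (p.app Y)

/-- The finitely presented functors. They are automatically additive,
see `Presentation.additive`. -/
def finitelyPresented (A : Type u) [Category.{v} A] [Preadditive A] :
    ObjectProperty (Aᵒᵖ ⥤ AddCommGrpCat.{v}) :=
  fun F => Nonempty (Presentation F)

namespace Presentation

variable {F G : Aᵒᵖ ⥤ AddCommGrpCat.{v}}

/-- The value at `g : Y ⟶ X₀` of the projection `A(-, X₀) ⟶ F`. -/
def val (P : Presentation F) {Y : A} (g : Y ⟶ P.X₀) : F.obj (op Y) := P.p.app (op Y) g

lemma val_add (P : Presentation F) {Y : A} (g g' : Y ⟶ P.X₀) :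
    P.val (g + g') = P.val g + P.val g' :=
  (P.p.app (op Y)).hom.map_add g g'

lemma val_sub (P : Presentation F) {Y : A} (g g' : Y ⟶ P.X₀) :
    P.val (g - g') = P.val g - P.val g' :=
  (P.p.app (op Y)).hom.map_sub g g'

lemma map_val (P : Presentation F) {Y Z : A} (h : Z ⟶ Y) (g : Y ⟶ P.X₀) :
    F.map h.op (P.val g) = P.val (h ≫ g) :=
  (ConcreteCategory.congr_hom (P.p.naturality h.op) g).symm

lemma exists_val (P : Presentation F) {Y : A} (y : F.obj (op Y)) : ∃ g : Y ⟶ P.X₀, P.val g = y :=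
  P.surjective (op Y) y

lemma val_eq_zero_iff (P : Presentation F) {Y : A} (g : Y ⟶ P.X₀) :
    P.val g = 0 ↔ ∃ h : Y ⟶ P.X₁, h ≫ P.d = g :=
  P.exact (op Y) g

lemma additive (P : Presentation F) : F.Additive where
  map_add {Y Z f g} := by
    ext y
    obtain ⟨a, rfl⟩ := P.exists_val y
    have h1 := P.map_val f.unop a
    have h2 := P.map_val g.unop a
    have h3 := P.map_val (f + g).unop a
    have h4 : (f + g).unop ≫ a = f.unop ≫ a + g.unop ≫ a := by simp
    rw [h4, val_add, ← h1, ← h2] at h3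
    exact h3

end Presentation

/-- The morphism `A(-, X) ⟶ F` corresponding to an element of `F(X)`. -/
def yonedaLift (F : Aᵒᵖ ⥤ AddCommGrpCat.{v}) [F.Additive] {X : A} (x : F.obj (op X)) :
    preadditiveYoneda.obj X ⟶ F where
  app Y := AddCommGrpCat.ofHom
    { toFun := fun g : unop Y ⟶ X => F.map g.op x
      map_zero' := by
        change F.map (Quiver.Hom.op (0 : unop Y ⟶ X)) x = 0
        rw [op_zero, F.map_zero]
        rfl
      map_add' := fun (g g' : unop Y ⟶ X) => by
        change F.map (Quiver.Hom.op (g + g')) x = _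
        rw [op_add, F.map_add]
        rfl }
  naturality Y Z f := by
    ext g
    exact ConcreteCategory.congr_hom (F.map_comp (Quiver.Hom.op g) f) x

lemma yonedaLift_app (F : Aᵒᵖ ⥤ AddCommGrpCat.{v}) [F.Additive] {X : A} (x : F.obj (op X))
    {Y : A} (g : Y ⟶ X) : (yonedaLift F x).app (op Y) g = F.map g.op x := rfl

lemma app_yoneda {X : A} {F : Aᵒᵖ ⥤ AddCommGrpCat.{v}} (α : preadditiveYoneda.obj X ⟶ F)
    {Y : A} (g : Y ⟶ X) : α.app (op Y) g = F.map g.op (α.app (op X) (𝟙 X)) := by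
  have h := ConcreteCategory.congr_hom (α.naturality g.op) (𝟙 X)
  have h2 : (preadditiveYoneda.obj X).map g.op (𝟙 X) = g := Category.comp_id g
  exact (congrArg (α.app (op Y)) h2).symm.trans h

lemma yoneda_hom_ext {X : A} {F : Aᵒᵖ ⥤ AddCommGrpCat.{v}} {α β : preadditiveYoneda.obj X ⟶ F}
    (h : α.app (op X) (𝟙 X) = β.app (op X) (𝟙 X)) : α = β := by
  ext ⟨Y⟩ g
  exact (app_yoneda α g).trans ((congrArg (F.map (Quiver.Hom.op g)) h).trans (app_yoneda β g).symm)

namespace Presentation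

variable {F G : Aᵒᵖ ⥤ AddCommGrpCat.{v}}

/-- A presentation given by a generator and its relations. -/
def ofElement [F.Additive] {X₁ X₀ : A} (d : X₁ ⟶ X₀) (x : F.obj (op X₀))
    (hsurj : ∀ ⦃Y : A⦄ (y : F.obj (op Y)), ∃ g : Y ⟶ X₀, F.map g.op x = y)
    (hrel : ∀ ⦃Y : A⦄ (g : Y ⟶ X₀), F.map g.op x = 0 ↔ ∃ h : Y ⟶ X₁, h ≫ d = g) :
    Presentation F where
  X₁ := X₁
  X₀ := X₀
  d := d
  p := yonedaLift F x
  exact Y g := hrel (Y := unop Y) g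
  surjective Y y := hsurj (Y := unop Y) y

lemma app_eq_of_val_eq (P : Presentation F) (α : preadditiveYoneda.obj P.X₀ ⟶ G)
    (hα : preadditiveYoneda.map P.d ≫ α = 0) {Y : A} {g g' : Y ⟶ P.X₀}
    (h : P.val g = P.val g') : α.app (op Y) g = α.app (op Y) g' := by
  have h1 : P.val (g - g') = 0 := by rw [val_sub, h, sub_self]
  obtain ⟨t, ht⟩ := (P.val_eq_zero_iff _).1 h1
  have h2 : α.app (op Y) (g - g') = 0 := by
    rw [← ht]
    exact ConcreteCategory.congr_hom (NatTrans.congr_app hα (op Y)) t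
  exact sub_eq_zero.1 (((α.app (op Y)).hom.map_sub g g').symm.trans h2)

/-- A morphism out of a functor with a given presentation. -/
def desc (P : Presentation F) (α : preadditiveYoneda.obj P.X₀ ⟶ G)
    (hα : preadditiveYoneda.map P.d ≫ α = 0) : F ⟶ G where
  app Y := AddCommGrpCat.ofHom
    (AddMonoidHom.mk' (fun y => α.app Y (P.exists_val (Y := unop Y) y).choose) (fun y z => by
      refine (P.app_eq_of_val_eq α hα (Y := unop Y) ?_).trans
        ((α.app Y).hom.map_add (P.exists_val (Y := unop Y) y).choose
          (P.exists_val (Y := unop Y) z).choose)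
      refine (P.exists_val (Y := unop Y) (y + z)).choose_spec.trans
        (Eq.trans ?_ (P.val_add (Y := unop Y) _ _).symm)
      rw [(P.exists_val (Y := unop Y) y).choose_spec,
        (P.exists_val (Y := unop Y) z).choose_spec]))
  naturality Y Z f := by
    ext y
    refine (P.app_eq_of_val_eq α hα (Y := unop Z) ?_).trans
      (ConcreteCategory.congr_hom (α.naturality f) (P.exists_val (Y := unop Y) y).choose)
    refine (P.exists_val (Y := unop Z) (F.map f y)).choose_spec.trans ?_
    refine Eq.trans ?_ (P.map_val f.unop _)
    rw [(P.exists_val (Y := unop Y) y).choose_spec]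
    rfl

lemma desc_val (P : Presentation F) (α : preadditiveYoneda.obj P.X₀ ⟶ G)
    (hα : preadditiveYoneda.map P.d ≫ α = 0) {Y : A} (g : Y ⟶ P.X₀) :
    (P.desc α hα).app (op Y) (P.val g) = α.app (op Y) g :=
  P.app_eq_of_val_eq α hα (P.exists_val (P.val g)).choose_spec

lemma hom_ext (P : Presentation F) {α β : F ⟶ G}
    (h : α.app (op P.X₀) (P.val (𝟙 _)) = β.app (op P.X₀) (P.val (𝟙 _))) : α = β := by
  ext ⟨Y⟩ y
  obtain ⟨g, rfl⟩ := P.exists_val y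
  have h1 : P.val g = F.map g.op (P.val (𝟙 _)) := by rw [map_val, Category.comp_id]
  rw [h1]
  refine (ConcreteCategory.congr_hom (α.naturality g.op) _).trans
    (Eq.trans ?_ (ConcreteCategory.congr_hom (β.naturality g.op) _).symm)
  exact congrArg (G.map g.op) h

end Presentation

lemma exact_app {F G H : Aᵒᵖ ⥤ AddCommGrpCat.{v}} {f : F ⟶ G} {g : G ⟶ H} (w : f ≫ g = 0)
    (h : (ShortComplex.mk f g w).Exact) (Y : Aᵒᵖ) : Function.Exact (f.app Y) (g.app Y) := by
  have h' := h.map ((evaluation _ _).obj Y)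
  rw [ShortComplex.ab_exact_iff_function_exact] at h'
  exact h'

lemma naturality_apply {F G : Aᵒᵖ ⥤ AddCommGrpCat.{v}} (α : F ⟶ G) {Y Z : Aᵒᵖ} (f : Y ⟶ Z)
    (y : F.obj Y) : α.app Z (F.map f y) = G.map f (α.app Y y) :=
  ConcreteCategory.congr_hom (α.naturality f) y

lemma additive_of_injective {F G : Aᵒᵖ ⥤ AddCommGrpCat.{v}} [G.Additive] (α : F ⟶ G)
    (h : ∀ Y, Function.Injective (α.app Y)) : F.Additive where
  map_add {Y Z f g} := by
    ext y
    apply h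
    have e : α.app Z (F.map f y + F.map g y) = α.app Z (F.map f y) + α.app Z (F.map g y) :=
      (α.app Z).hom.map_add _ _
    refine Eq.trans ?_ e.symm
    rw [naturality_apply, naturality_apply, naturality_apply, G.map_add]
    rfl

instance : (finitelyPresented A).IsClosedUnderIsomorphisms where
  of_iso {F G} e := by
    rintro ⟨P⟩
    have hi : ∀ Y (y : F.obj Y), e.inv.app Y (e.hom.app Y y) = y := fun Y y =>
      ConcreteCategory.congr_hom (NatTrans.congr_app e.hom_inv_id Y) y
    have hi' : ∀ Y (y : G.obj Y), e.hom.app Y (e.inv.app Y y) = y := fun Y y =>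
      ConcreteCategory.congr_hom (NatTrans.congr_app e.inv_hom_id Y) y
    refine ⟨⟨P.X₁, P.X₀, P.d, P.p ≫ e.hom, fun Y g => ?_, fun Y y => ?_⟩⟩
    · rw [← P.exact Y g]
      constructor
      · intro h
        have h2 := congrArg (e.inv.app Y) h
        exact (hi Y _).symm.trans (h2.trans ((e.inv.app Y).hom.map_zero))
      · intro h
        exact (congrArg (e.hom.app Y) h).trans ((e.hom.app Y).hom.map_zero)
    · obtain ⟨g, hg⟩ := P.surjective Y (e.inv.app Y y)
      exact ⟨g, (congrArg (e.hom.app Y) hg).trans (hi' Y y)⟩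

instance [Nonempty A] : (finitelyPresented A).ContainsZero where
  exists_zero := by
    obtain ⟨X⟩ := ‹Nonempty A›
    refine ⟨0, isZero_zero _, ⟨⟨X, X, 𝟙 X, 0, fun Y g => ?_, fun Y y => ⟨0, ?_⟩⟩⟩⟩
    · exact ⟨fun _ => ⟨g, Category.comp_id (show unop Y ⟶ X from g)⟩, fun _ => rfl⟩
    · have h : 𝟙 (0 : Aᵒᵖ ⥤ AddCommGrpCat.{v}) = 0 := (isZero_zero _).eq_of_src _ _
      exact (ConcreteCategory.congr_hom (NatTrans.congr_app h Y) y).symm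

instance [HasBinaryBiproducts A] : (finitelyPresented A).IsClosedUnderCokernels where
  cokernels_le := by
    rintro _ ⟨α, k, hk, ⟨P⟩, ⟨Q⟩⟩
    rename_i F G
    have hex : ∀ Y, Function.Exact (α.app Y) (k.π.app Y) := fun Y =>
      exact_app k.condition (ShortComplex.exact_of_g_is_cokernel (ShortComplex.mk α k.π k.condition)
        (IsColimit.ofIsoColimit hk (Cofork.ext (Iso.refl _)))) Y
    have hepi : Epi k.π := Cofork.IsColimit.epi hk
    have hsurj : ∀ Y, Function.Surjective (k.π.app Y) := fun Y =>
      (AddCommGrpCat.epi_iff_surjective _).1 ((NatTrans.epi_iff_epi_app _).1 hepi Y)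
    obtain ⟨b, hb⟩ := Q.exists_val (α.app _ (P.val (𝟙 _)))
    have hα : ∀ {Y : A} (h : Y ⟶ P.X₀), α.app (op Y) (P.val h) = Q.val (h ≫ b) := fun h => by
      rw [← Q.map_val, hb, ← naturality_apply, P.map_val, Category.comp_id]
    refine ⟨⟨P.X₀ ⊞ Q.X₁, Q.X₀, biprod.desc b Q.d, Q.p ≫ k.π, fun Y (g : unop Y ⟶ Q.X₀) => ?_,
      fun Y => (hsurj Y).comp (Q.surjective Y)⟩⟩
    refine (hex Y (Q.val g)).trans ?_
    constructor
    · rintro ⟨x, hx⟩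
      obtain ⟨h, rfl⟩ := P.exists_val (Y := unop Y) x
      rw [hα (Y := unop Y)] at hx
      have h0 : Q.val (g - h ≫ b) = 0 := by rw [Q.val_sub, ← hx, sub_self]
      obtain ⟨t, ht⟩ := (Q.val_eq_zero_iff _).1 h0
      refine ⟨biprod.lift h t, ?_⟩
      change biprod.lift h t ≫ biprod.desc b Q.d = g
      rw [biprod.lift_desc, ht]
      abel
    · rintro ⟨(t : unop Y ⟶ P.X₀ ⊞ Q.X₁), ht⟩
      refine ⟨P.val (Y := unop Y) (t ≫ biprod.fst), ?_⟩
      have ht' : t ≫ biprod.desc b Q.d = g := ht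
      rw [hα (Y := unop Y)]
      refine sub_eq_zero.1 ?_
      rw [← Q.val_sub, Q.val_eq_zero_iff]
      refine ⟨-(t ≫ biprod.snd), ?_⟩
      rw [← ht', biprod.desc_eq]
      simp

lemma finitelyPresented_biprod [HasBinaryBiproducts A] {F G : Aᵒᵖ ⥤ AddCommGrpCat.{v}}
    (hF : finitelyPresented A F) (hG : finitelyPresented A G) :
    finitelyPresented A (F ⊞ G) := by
  obtain ⟨P⟩ := hF
  obtain ⟨Q⟩ := hG
  have h1 : ∀ Y (x : F.obj Y) (y : G.obj Y),
      (biprod.fst : F ⊞ G ⟶ F).app Y ((biprod.inl : F ⟶ F ⊞ G).app Y x +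
        (biprod.inr : G ⟶ F ⊞ G).app Y y) = x := fun Y x y => by
    have e1 := ConcreteCategory.congr_hom (NatTrans.congr_app (biprod.inl_fst (X := F) (Y := G)) Y) x
    have e2 := ConcreteCategory.congr_hom (NatTrans.congr_app (biprod.inr_fst (X := F) (Y := G)) Y) y
    refine (((biprod.fst : F ⊞ G ⟶ F).app Y).hom.map_add _ _).trans ?_
    exact (congrArg₂ (· + ·) e1 e2).trans (add_zero x)
  have h2 : ∀ Y (x : F.obj Y) (y : G.obj Y),
      (biprod.snd : F ⊞ G ⟶ G).app Y ((biprod.inl : F ⟶ F ⊞ G).app Y x +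
        (biprod.inr : G ⟶ F ⊞ G).app Y y) = y := fun Y x y => by
    have e1 := ConcreteCategory.congr_hom (NatTrans.congr_app (biprod.inl_snd (X := F) (Y := G)) Y) x
    have e2 := ConcreteCategory.congr_hom (NatTrans.congr_app (biprod.inr_snd (X := F) (Y := G)) Y) y
    refine (((biprod.snd : F ⊞ G ⟶ G).app Y).hom.map_add _ _).trans ?_
    exact (congrArg₂ (· + ·) e1 e2).trans (zero_add y)
  have h3 : ∀ Y (z : (F ⊞ G).obj Y), (biprod.inl : F ⟶ F ⊞ G).app Y
      ((biprod.fst : F ⊞ G ⟶ F).app Y z) + (biprod.inr : G ⟶ F ⊞ G).app Y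
      ((biprod.snd : F ⊞ G ⟶ G).app Y z) = z := fun Y z =>
    ConcreteCategory.congr_hom (NatTrans.congr_app (biprod.total (X := F) (Y := G)) Y) z
  refine ⟨⟨P.X₁ ⊞ Q.X₁, P.X₀ ⊞ Q.X₀, biprod.map P.d Q.d,
    preadditiveYoneda.map biprod.fst ≫ P.p ≫ biprod.inl +
      preadditiveYoneda.map biprod.snd ≫ Q.p ≫ biprod.inr,
      fun Y (g : unop Y ⟶ P.X₀ ⊞ Q.X₀) => ?_, fun Y z => ?_⟩⟩
  · change (biprod.inl : F ⟶ F ⊞ G).app Y (P.val (Y := unop Y) (g ≫ biprod.fst)) +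
      (biprod.inr : G ⟶ F ⊞ G).app Y (Q.val (Y := unop Y) (g ≫ biprod.snd)) = 0 ↔
      ∃ t : unop Y ⟶ P.X₁ ⊞ Q.X₁, t ≫ biprod.map P.d Q.d = g
    constructor
    · intro h
      have e1 := h1 Y (P.val (Y := unop Y) (g ≫ biprod.fst)) (Q.val (Y := unop Y) (g ≫ biprod.snd))
      have e2 := h2 Y (P.val (Y := unop Y) (g ≫ biprod.fst)) (Q.val (Y := unop Y) (g ≫ biprod.snd))
      rw [h] at e1 e2
      obtain ⟨s, hs⟩ := (P.val_eq_zero_iff (Y := unop Y) (g ≫ biprod.fst)).1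
        (e1.symm.trans (((biprod.fst : F ⊞ G ⟶ F).app Y).hom.map_zero))
      obtain ⟨t, ht⟩ := (Q.val_eq_zero_iff (Y := unop Y) (g ≫ biprod.snd)).1
        (e2.symm.trans (((biprod.snd : F ⊞ G ⟶ G).app Y).hom.map_zero))
      refine ⟨biprod.lift s t, ?_⟩
      ext <;> simp [hs, ht]
    · rintro ⟨t, rfl⟩
      have e1 : P.val (Y := unop Y) ((t ≫ biprod.map P.d Q.d) ≫ biprod.fst) = 0 :=
        (P.val_eq_zero_iff _).2 ⟨t ≫ biprod.fst, by simp⟩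
      have e2 : Q.val (Y := unop Y) ((t ≫ biprod.map P.d Q.d) ≫ biprod.snd) = 0 :=
        (Q.val_eq_zero_iff _).2 ⟨t ≫ biprod.snd, by simp⟩
      rw [e1, e2]
      refine (congrArg₂ (· + ·) ((biprod.inl : F ⟶ F ⊞ G).app Y).hom.map_zero
        ((biprod.inr : G ⟶ F ⊞ G).app Y).hom.map_zero).trans (add_zero _)
  · obtain ⟨s, hs⟩ := P.exists_val (Y := unop Y) ((biprod.fst : F ⊞ G ⟶ F).app Y z)
    obtain ⟨t, ht⟩ := Q.exists_val (Y := unop Y) ((biprod.snd : F ⊞ G ⟶ G).app Y z)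
    refine ⟨biprod.lift s t, ?_⟩
    change (biprod.inl : F ⟶ F ⊞ G).app Y (P.val (Y := unop Y) (biprod.lift s t ≫ biprod.fst)) +
      (biprod.inr : G ⟶ F ⊞ G).app Y (Q.val (Y := unop Y) (biprod.lift s t ≫ biprod.snd)) = z
    rw [biprod.lift_fst, biprod.lift_snd, hs, ht]
    exact h3 Y z

instance [HasBinaryBiproducts A] : (finitelyPresented A).IsClosedUnderBinaryProducts where
  limitsOfShape_le := by
    rintro X ⟨p⟩
    refine (finitelyPresented A).prop_of_iso ?_ (finitelyPresented_biprod
      (p.prop_diag_obj ⟨WalkingPair.left⟩) (p.prop_diag_obj ⟨WalkingPair.right⟩))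
    exact biprod.isoProd _ _ ≪≫ HasLimit.isoOfNatIso (diagramIsoPair p.diag).symm ≪≫
      limit.isoLimitCone ⟨_, p.isLimit⟩

instance [HasBinaryBiproducts A] [Nonempty A] :
    (finitelyPresented A).IsClosedUnderFiniteProducts :=
  ObjectProperty.IsClosedUnderFiniteProducts.mk'

end FinitelyPresented

section Relative

variable {C : Type u} [Category.{v} C]

/-- `𝒳` is contravariantly finite: every object `M` has a right `𝒳`-approximation, that is, a
morphism `Y ⟶ M` with `Y` in `𝒳` through which every morphism `Z ⟶ M` with `Z` in `𝒳` factors. -/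
class ContravariantlyFinite (𝒳 : ObjectProperty C) : Prop where
  exists_approximation (M : C) : ∃ (Y : C) (f : Y ⟶ M), 𝒳 Y ∧
    ∀ ⦃Z : C⦄ (g : Z ⟶ M), 𝒳 Z → ∃ h : Z ⟶ Y, h ≫ f = g

/-- `𝒳` contains the projective objects. -/
class ContainsProjectives (𝒳 : ObjectProperty C) : Prop where
  prop_of_projective (P : C) : Projective P → 𝒳 P

variable [Abelian C] (𝒳 : ObjectProperty C)

variable {𝒳} in
lemma exists_weak_pullback [ContravariantlyFinite 𝒳] {X Y Z : 𝒳.FullSubcategory}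
    (a : X ⟶ Z) (b : Y ⟶ Z) :
    ∃ (W : 𝒳.FullSubcategory) (p : W ⟶ X) (q : W ⟶ Y), p ≫ a = q ≫ b ∧
      ∀ ⦃T : 𝒳.FullSubcategory⦄ (f : T ⟶ X) (g : T ⟶ Y), f ≫ a = g ≫ b →
        ∃ h : T ⟶ W, h ≫ p = f ∧ h ≫ q = g := by
  obtain ⟨W, w, hW, hw⟩ :=
    ContravariantlyFinite.exists_approximation (𝒳 := 𝒳) (pullback a.hom b.hom)
  refine ⟨⟨W, hW⟩, ObjectProperty.homMk (w ≫ pullback.fst _ _),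
    ObjectProperty.homMk (w ≫ pullback.snd _ _), ?_, ?_⟩
  · apply ObjectProperty.hom_ext
    simp [pullback.condition]
  · intro T f g hfg
    have e : f.hom ≫ a.hom = g.hom ≫ b.hom := congrArg (fun t => t.hom) hfg
    obtain ⟨h, hh⟩ := hw (pullback.lift f.hom g.hom e) T.property
    refine ⟨ObjectProperty.homMk h, ?_, ?_⟩
    · apply ObjectProperty.hom_ext
      exact ((reassoc_of% hh) (pullback.fst _ _)).trans (pullback.lift_fst _ _ _)
    · apply ObjectProperty.hom_ext
      exact ((reassoc_of% hh) (pullback.snd _ _)).trans (pullback.lift_snd _ _ _)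

variable {𝒳} in
/-- The relations of an arbitrary element of a finitely presented functor are finitely
generated. -/
lemma Presentation.exists_relations [ContravariantlyFinite 𝒳]
    {F : 𝒳.FullSubcategoryᵒᵖ ⥤ AddCommGrpCat.{v}} (P : Presentation F) {X : 𝒳.FullSubcategory}
    (x : F.obj (op X)) : ∃ (W : 𝒳.FullSubcategory) (w : W ⟶ X),
      ∀ ⦃Y : 𝒳.FullSubcategory⦄ (g : Y ⟶ X), F.map g.op x = 0 ↔ ∃ h : Y ⟶ W, h ≫ w = g := by
  obtain ⟨a, rfl⟩ := P.exists_val x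
  obtain ⟨W, p, q, hpq, hW⟩ := exists_weak_pullback a P.d
  refine ⟨W, p, fun Y g => ?_⟩
  rw [P.map_val, P.val_eq_zero_iff]
  constructor
  · rintro ⟨t, ht⟩
    obtain ⟨h, h1, -⟩ := hW g t ht.symm
    exact ⟨h, h1⟩
  · rintro ⟨h, rfl⟩
    exact ⟨h ≫ q, by simp [hpq]⟩

instance [ContravariantlyFinite 𝒳] :
    (finitelyPresented 𝒳.FullSubcategory).IsClosedUnderKernels where
  kernels_le := by
    rintro _ ⟨α, k, hk, ⟨P⟩, ⟨Q⟩⟩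
    have hex : ∀ Y, Function.Exact (k.ι.app Y) (α.app Y) := fun Y =>
      exact_app k.condition (ShortComplex.exact_of_f_is_kernel (ShortComplex.mk k.ι α k.condition)
        (IsLimit.ofIsoLimit hk (Fork.ext (Iso.refl _)))) Y
    have hmono : Mono k.ι := Fork.IsLimit.mono hk
    have hinj : ∀ Y, Function.Injective (k.ι.app Y) := fun Y =>
      (AddCommGrpCat.mono_iff_injective _).1 ((NatTrans.mono_iff_mono_app _).1 hmono Y)
    have := P.additive
    have : k.pt.Additive := additive_of_injective k.ι hinj
    obtain ⟨W, w, hw⟩ := Q.exists_relations (α.app _ (P.val (𝟙 _)))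
    have hα : ∀ {Y : 𝒳.FullSubcategory} (g : Y ⟶ P.X₀),
        α.app (op Y) (P.val g) = 0 ↔ ∃ h : Y ⟶ W, h ≫ w = g := fun g => by
      rw [← hw g, ← naturality_apply, P.map_val, Category.comp_id]
    obtain ⟨x, hx⟩ := (hex _ (P.val w)).1 ((hα w).2 ⟨𝟙 _, by simp⟩)
    obtain ⟨V, d, hd⟩ := P.exists_relations (P.val w)
    have hmap : ∀ {Y : 𝒳.FullSubcategory} (g : Y ⟶ W),
        k.ι.app (op Y) (k.pt.map g.op x) = P.val (g ≫ w) := fun g => by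
      rw [naturality_apply, ← P.map_val]
      exact congrArg _ hx
    refine ⟨Presentation.ofElement d x (fun Y y => ?_) (fun Y g => ?_)⟩
    · obtain ⟨g, hg⟩ := P.exists_val (k.ι.app (op Y) y)
      obtain ⟨h, rfl⟩ := (hα g).1 (by rw [hg]; exact (hex _ _).2 ⟨y, rfl⟩)
      exact ⟨h, hinj _ ((hmap h).trans hg)⟩
    · rw [← hd g, P.map_val, ← hmap]
      constructor
      · intro h
        exact (congrArg _ h).trans (k.ι.app (op Y)).hom.map_zero
      · intro h
        exact hinj _ (h.trans (k.ι.app (op Y)).hom.map_zero.symm)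

lemma hasBinaryBiproducts_fullSubcategory [𝒳.IsClosedUnderFiniteProducts] :
    HasBinaryBiproducts 𝒳.FullSubcategory :=
  HasBinaryBiproducts.of_hasBinaryProducts

/-- The category `mod-𝒳` of finitely presented contravariant functors from `𝒳` to abelian
groups. -/
abbrev ModCat := (finitelyPresented 𝒳.FullSubcategory).FullSubcategory

instance [ContravariantlyFinite 𝒳] [𝒳.IsClosedUnderFiniteProducts] : Abelian (ModCat 𝒳) :=
  have := hasBinaryBiproducts_fullSubcategory 𝒳
  have : Nonempty 𝒳.FullSubcategory := ⟨⟨_, 𝒳.prop_of_isTerminal _ terminalIsTerminal⟩⟩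
  inferInstance

end Relative

section RelativeRecollement

variable {C : Type u} [Category.{v} C] [Abelian C] (𝒳 : ObjectProperty C)

/-- The functor `Hom(-, M)` restricted to `𝒳`. -/
def restrictedYoneda : C ⥤ 𝒳.FullSubcategoryᵒᵖ ⥤ AddCommGrpCat.{v} :=
  preadditiveYoneda ⋙ (Functor.whiskeringLeft _ _ _).obj 𝒳.ι.op

instance (M : C) : ((restrictedYoneda 𝒳).obj M).Additive := by
  unfold restrictedYoneda
  dsimp
  infer_instance

instance : (restrictedYoneda 𝒳).Additive where
  map_add {M N f g} := by
    ext Y h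
    exact Preadditive.comp_add _ _ _ h f g

lemma finitelyPresented_restrictedYoneda [ContravariantlyFinite 𝒳] (M : C) :
    finitelyPresented _ ((restrictedYoneda 𝒳).obj M) := by
  obtain ⟨X₀, x, hX₀, hx⟩ := ContravariantlyFinite.exists_approximation (𝒳 := 𝒳) M
  obtain ⟨X₁, y, hX₁, hy⟩ := ContravariantlyFinite.exists_approximation (𝒳 := 𝒳) (kernel x)
  refine ⟨Presentation.ofElement (X₁ := ⟨X₁, hX₁⟩) (X₀ := ⟨X₀, hX₀⟩)
    (ObjectProperty.homMk (y ≫ kernel.ι x)) x (fun Y g => ?_) (fun Y g => ?_)⟩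
  · obtain ⟨h, hh⟩ := hx g Y.property
    exact ⟨ObjectProperty.homMk h, hh⟩
  · change g.hom ≫ x = 0 ↔ _
    constructor
    · intro h
      obtain ⟨t, ht⟩ := hy (kernel.lift x g.hom h) Y.property
      refine ⟨ObjectProperty.homMk t, ?_⟩
      apply ObjectProperty.hom_ext
      exact ((reassoc_of% ht) (kernel.ι x)).trans (kernel.lift_ι _ _ _)
    · rintro ⟨t, rfl⟩
      simp

/-- The functor `ϑ_ρ : C ⥤ mod-𝒳`, `M ↦ Hom(-, M)|_𝒳`. -/
def thetaR [ContravariantlyFinite 𝒳] : C ⥤ ModCat 𝒳 :=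
  (finitelyPresented _).lift (restrictedYoneda 𝒳) (finitelyPresented_restrictedYoneda 𝒳)

instance [ContravariantlyFinite 𝒳] : (thetaR 𝒳).Additive where
  map_add {M N f g} := by
    apply ObjectProperty.hom_ext
    exact (restrictedYoneda 𝒳).map_add

variable {𝒳} in
/-- A chosen presentation of an object of `mod-𝒳`. -/
def pres (F : ModCat 𝒳) : Presentation F.obj := F.property.some

variable {𝒳} in
/-- The value of `ϑ` at `F`: the cokernel of `d : X₁ ⟶ X₀` for the chosen presentation
`𝒳(-, X₁) ⟶ 𝒳(-, X₀) ⟶ F ⟶ 0`. -/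
def thetaObj (F : ModCat 𝒳) : C := cokernel (pres F).d.hom

variable {𝒳} in
/-- The projection `X₀ ⟶ ϑ F`. -/
def thetaπ (F : ModCat 𝒳) : (pres F).X₀.obj ⟶ thetaObj F := cokernel.π (pres F).d.hom

variable {𝒳} in
instance (F : ModCat 𝒳) : Epi (thetaπ F) := inferInstanceAs (Epi (cokernel.π _))

variable {𝒳} in
lemma d_thetaπ (F : ModCat 𝒳) : (pres F).d.hom ≫ thetaπ F = 0 := cokernel.condition _

variable {𝒳} in
lemma pres_map_comp_yonedaLift (F : ModCat 𝒳) {M : C} (φ : thetaObj F ⟶ M) :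
    preadditiveYoneda.map (pres F).d ≫ yonedaLift ((restrictedYoneda 𝒳).obj M)
      (X := (pres F).X₀) (thetaπ F ≫ φ) = 0 := by
  apply yoneda_hom_ext
  change ((𝟙 (pres F).X₁) ≫ (pres F).d).hom ≫ thetaπ F ≫ φ = 0
  rw [Category.id_comp, ← Category.assoc, d_thetaπ, zero_comp]

variable {𝒳} in
/-- The value of `F ⟶ Hom(-, M)|_𝒳` at the generator of `F`. -/
def genValue [ContravariantlyFinite 𝒳] {F : ModCat 𝒳} {M : C} (α : F ⟶ (thetaR 𝒳).obj M) :
    (pres F).X₀.obj ⟶ M :=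
  α.hom.app (op (pres F).X₀) ((pres F).val (𝟙 _))

variable {𝒳} in
lemma d_genValue [ContravariantlyFinite 𝒳] {F : ModCat 𝒳} {M : C} (α : F ⟶ (thetaR 𝒳).obj M) :
    (pres F).d.hom ≫ genValue α = 0 := by
  have h := naturality_apply α.hom (pres F).d.op ((pres F).val (𝟙 _))
  refine h.symm.trans ?_
  rw [Presentation.map_val, ((pres F).val_eq_zero_iff _).2 ⟨𝟙 _, by simp⟩]
  exact (α.hom.app (op (pres F).X₁)).hom.map_zero

variable {𝒳} in
lemma genValue_ext [ContravariantlyFinite 𝒳] {F : ModCat 𝒳} {M : C}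
    {α β : F ⟶ (thetaR 𝒳).obj M} (h : genValue α = genValue β) : α = β := by
  apply ObjectProperty.hom_ext
  apply (pres F).hom_ext
  exact h

variable {𝒳} in
/-- The morphism `F ⟶ Hom(-, M)|_𝒳` induced by `ϑ F ⟶ M`. -/
def thetaLift [ContravariantlyFinite 𝒳] {F : ModCat 𝒳} {M : C} (φ : thetaObj F ⟶ M) :
    F ⟶ (thetaR 𝒳).obj M :=
  ObjectProperty.homMk ((pres F).desc
    (yonedaLift ((restrictedYoneda 𝒳).obj M) (thetaπ F ≫ φ)) (pres_map_comp_yonedaLift F φ))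

variable {𝒳} in
lemma thetaLift_val [ContravariantlyFinite 𝒳] {F : ModCat 𝒳} {M : C} (φ : thetaObj F ⟶ M)
    {Y : 𝒳.FullSubcategory} (g : Y ⟶ (pres F).X₀) :
    (thetaLift φ).hom.app (op Y) ((pres F).val g) = (g.hom ≫ thetaπ F ≫ φ : Y.obj ⟶ M) :=
  (pres F).desc_val _ (pres_map_comp_yonedaLift F φ) g

variable {𝒳} in
lemma genValue_thetaLift [ContravariantlyFinite 𝒳] {F : ModCat 𝒳} {M : C} (φ : thetaObj F ⟶ M) :
    genValue (thetaLift φ) = thetaπ F ≫ φ :=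
  (thetaLift_val φ (𝟙 _)).trans (Category.id_comp _)

variable {𝒳} in
/-- The adjunction bijection between `ϑ` and `ϑ_ρ`. -/
def thetaHomEquiv [ContravariantlyFinite 𝒳] (F : ModCat 𝒳) (M : C) :
    (thetaObj F ⟶ M) ≃ (F ⟶ (thetaR 𝒳).obj M) where
  toFun φ := thetaLift φ
  invFun α := cokernel.desc _ (genValue α) (d_genValue α)
  left_inv φ := by
    apply (cancel_epi (thetaπ F)).1
    exact (cokernel.π_desc _ _ _).trans (genValue_thetaLift φ)
  right_inv α := by
    apply genValue_ext
    exact (genValue_thetaLift _).trans (cokernel.π_desc _ _ _)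

variable {𝒳} in
lemma thetaHomEquiv_naturality [ContravariantlyFinite 𝒳] (F : ModCat 𝒳) (M N : C) (f : M ⟶ N)
    (φ : thetaObj F ⟶ M) :
    thetaHomEquiv F N (φ ≫ f) = thetaHomEquiv F M φ ≫ (thetaR 𝒳).map f := by
  apply genValue_ext
  refine (genValue_thetaLift (φ ≫ f)).trans ?_
  change _ = genValue (thetaLift φ) ≫ f
  rw [genValue_thetaLift, Category.assoc]

/-- The functor `ϑ : mod-𝒳 ⥤ C`, sending a functor with presentation
`𝒳(-, X₁) ⟶ 𝒳(-, X₀) ⟶ F ⟶ 0` to the cokernel of `X₁ ⟶ X₀`. -/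
def theta [ContravariantlyFinite 𝒳] : ModCat 𝒳 ⥤ C :=
  Adjunction.leftAdjointOfEquiv thetaHomEquiv thetaHomEquiv_naturality

/-- The adjunction `ϑ ⊣ ϑ_ρ`. -/
def thetaAdjR [ContravariantlyFinite 𝒳] : theta 𝒳 ⊣ thetaR 𝒳 :=
  Adjunction.adjunctionOfEquivLeft thetaHomEquiv thetaHomEquiv_naturality

variable {𝒳} in
lemma thetaAdjR_unit_val [ContravariantlyFinite 𝒳] (F : ModCat 𝒳) {Y : 𝒳.FullSubcategory}
    (g : Y ⟶ (pres F).X₀) :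
    ((thetaAdjR 𝒳).unit.app F).hom.app (op Y) ((pres F).val g) =
      (g.hom ≫ thetaπ F : Y.obj ⟶ thetaObj F) := by
  have h : (thetaAdjR 𝒳).unit.app F = thetaLift (𝟙 (thetaObj F)) :=
    Adjunction.adjunctionOfEquivLeft_unit_app _ thetaHomEquiv_naturality F
  rw [h]
  refine (thetaLift_val (𝟙 _) g).trans ?_
  rw [Category.comp_id]

variable {𝒳} in
lemma thetaAdjR_unit_bijective [ContravariantlyFinite 𝒳] (F : ModCat 𝒳) (Q : 𝒳.FullSubcategory)
    [Projective Q.obj] :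
    Function.Bijective (fun y : F.obj.obj (op Q) =>
      (((thetaAdjR 𝒳).unit.app F).hom.app (op Q) y : Q.obj ⟶ (theta 𝒳).obj F)) := by
  constructor
  · refine (injective_iff_map_eq_zero (((thetaAdjR 𝒳).unit.app F).hom.app (op Q)).hom).2 ?_
    intro y hy
    obtain ⟨g, rfl⟩ := (pres F).exists_val y
    have hg : g.hom ≫ thetaπ F = 0 := (thetaAdjR_unit_val F g).symm.trans hy
    rw [Presentation.val_eq_zero_iff]
    have hex := ShortComplex.exact_cokernel (pres F).d.hom
    refine ⟨ObjectProperty.homMk (hex.liftFromProjective g.hom hg), ?_⟩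
    apply ObjectProperty.hom_ext
    exact hex.liftFromProjective_comp g.hom hg
  · intro (f : Q.obj ⟶ thetaObj F)
    refine ⟨(pres F).val (ObjectProperty.homMk
      (Projective.factorThru f (thetaπ F))), ?_⟩
    exact (thetaAdjR_unit_val F _).trans (Projective.factorThru_comp _ _)

variable {𝒳} in
/-- For `Q` projective, `F(Q)` is identified with `Hom(Q, ϑ F)`. -/
def evalEquiv [ContravariantlyFinite 𝒳] (F : ModCat 𝒳) (Q : 𝒳.FullSubcategory)
    [Projective Q.obj] : F.obj.obj (op Q) ≃ (Q.obj ⟶ (theta 𝒳).obj F) :=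
  Equiv.ofBijective _ (thetaAdjR_unit_bijective F Q)

variable {𝒳} in
lemma evalEquiv_map [ContravariantlyFinite 𝒳] (F : ModCat 𝒳) {P Q : 𝒳.FullSubcategory}
    [Projective P.obj] [Projective Q.obj] (d : P ⟶ Q) (y : F.obj.obj (op Q)) :
    evalEquiv F P (F.obj.map d.op y) = d.hom ≫ evalEquiv F Q y :=
  naturality_apply ((thetaAdjR 𝒳).unit.app F).hom d.op y

variable {𝒳} in
lemma evalEquiv_app [ContravariantlyFinite 𝒳] {F G : ModCat 𝒳} (α : F ⟶ G)
    (Q : 𝒳.FullSubcategory) [Projective Q.obj] (y : F.obj.obj (op Q)) :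
    evalEquiv G Q (α.hom.app (op Q) y) = evalEquiv F Q y ≫ (theta 𝒳).map α := by
  have h := congrArg (fun β => β.hom.app (op Q) y) ((thetaAdjR 𝒳).unit.naturality α)
  exact h

variable [EnoughProjectives C] [ContainsProjectives 𝒳]

variable {𝒳} in
/-- A projective object, regarded as an object of `𝒳`. -/
abbrev ofProjective (P : C) [h : Projective P] : 𝒳.FullSubcategory :=
  ⟨P, ContainsProjectives.prop_of_projective P h⟩

/-- The term `Q` of the chosen projective presentation `P ⟶ Q ⟶ M ⟶ 0`. -/
abbrev cover₀ (M : C) : 𝒳.FullSubcategory := ofProjective (Projective.over M)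

/-- The term `P` of the chosen projective presentation `P ⟶ Q ⟶ M ⟶ 0`. -/
abbrev cover₁ (M : C) : 𝒳.FullSubcategory :=
  ofProjective (Projective.over (kernel (Projective.π M)))

/-- The differential `P ⟶ Q` of the chosen projective presentation `P ⟶ Q ⟶ M ⟶ 0`. -/
def coverD (M : C) : cover₁ 𝒳 M ⟶ cover₀ 𝒳 M :=
  ObjectProperty.homMk (Projective.π (kernel (Projective.π M)) ≫ kernel.ι (Projective.π M))

/-- The presentation `𝒳(-, P) ⟶ 𝒳(-, Q) ⟶ ϑ_λ M ⟶ 0`. -/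
def thetaLPres (M : C) : Presentation (cokernel (preadditiveYoneda.map (coverD 𝒳 M))) where
  X₁ := cover₁ 𝒳 M
  X₀ := cover₀ 𝒳 M
  d := coverD 𝒳 M
  p := cokernel.π _
  exact := exact_app (cokernel.condition _) (ShortComplex.exact_cokernel _)
  surjective Y := (AddCommGrpCat.epi_iff_surjective _).1
    ((NatTrans.epi_iff_epi_app _).1 inferInstance Y)

/-- The value of `ϑ_λ` at `M`: the cokernel of `𝒳(-, P) ⟶ 𝒳(-, Q)`, for the chosen projective
presentation `P ⟶ Q ⟶ M ⟶ 0`. -/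
def thetaLObj (M : C) : ModCat 𝒳 :=
  ⟨cokernel (preadditiveYoneda.map (coverD 𝒳 M)), ⟨thetaLPres 𝒳 M⟩⟩

instance (F : ModCat 𝒳) : F.obj.Additive := (pres F).additive

variable {𝒳} in
/-- The value of `ϑ_λ M ⟶ F` at the generator of `ϑ_λ M`. -/
def genValueL {M : C} {F : ModCat 𝒳} (α : thetaLObj 𝒳 M ⟶ F) : F.obj.obj (op (cover₀ 𝒳 M)) :=
  α.hom.app (op (cover₀ 𝒳 M)) ((thetaLPres 𝒳 M).val (𝟙 (cover₀ 𝒳 M)))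

variable {𝒳} in
lemma map_genValueL {M : C} {F : ModCat 𝒳} (α : thetaLObj 𝒳 M ⟶ F) :
    F.obj.map (coverD 𝒳 M).op (genValueL α) = 0 := by
  have h := naturality_apply α.hom (coverD 𝒳 M).op ((thetaLPres 𝒳 M).val (𝟙 (cover₀ 𝒳 M)))
  refine h.symm.trans ?_
  have h2 : (thetaLObj 𝒳 M).obj.map (coverD 𝒳 M).op ((thetaLPres 𝒳 M).val (𝟙 (cover₀ 𝒳 M))) = 0 :=
    ((thetaLPres 𝒳 M).map_val (coverD 𝒳 M) (𝟙 (cover₀ 𝒳 M))).trans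
      (((thetaLPres 𝒳 M).val_eq_zero_iff _).2
        ⟨𝟙 (cover₁ 𝒳 M), (Category.id_comp _).trans (Category.comp_id _).symm⟩)
  rw [h2]
  exact (α.hom.app (op (cover₁ 𝒳 M))).hom.map_zero

variable {𝒳} in
lemma genValueL_ext {M : C} {F : ModCat 𝒳} {α β : thetaLObj 𝒳 M ⟶ F}
    (h : genValueL α = genValueL β) : α = β := by
  apply ObjectProperty.hom_ext
  apply (thetaLPres 𝒳 M).hom_ext
  exact h

variable {𝒳} in
lemma thetaLPres_comp_yonedaLift {M : C} {F : ModCat 𝒳} (y : F.obj.obj (op (cover₀ 𝒳 M)))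
    (hy : F.obj.map (coverD 𝒳 M).op y = 0) :
    preadditiveYoneda.map (thetaLPres 𝒳 M).d ≫ yonedaLift F.obj (X := cover₀ 𝒳 M) y = 0 := by
  apply yoneda_hom_ext
  change F.obj.map ((𝟙 _) ≫ coverD 𝒳 M).op y = 0
  rw [Category.id_comp, hy]

variable {𝒳} in
/-- The morphism `ϑ_λ M ⟶ F` given by an element of `F(Q)` that is killed by `F(P)`. -/
def thetaLDesc {M : C} {F : ModCat 𝒳} (y : F.obj.obj (op (cover₀ 𝒳 M)))
    (hy : F.obj.map (coverD 𝒳 M).op y = 0) : thetaLObj 𝒳 M ⟶ F :=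
  ObjectProperty.homMk ((thetaLPres 𝒳 M).desc (yonedaLift F.obj y) (thetaLPres_comp_yonedaLift y hy))

variable {𝒳} in
lemma genValueL_thetaLDesc {M : C} {F : ModCat 𝒳} (y : F.obj.obj (op (cover₀ 𝒳 M)))
    (hy : F.obj.map (coverD 𝒳 M).op y = 0) : genValueL (thetaLDesc y hy) = y :=
  ((thetaLPres 𝒳 M).desc_val (yonedaLift F.obj y) (thetaLPres_comp_yonedaLift y hy) (𝟙 (cover₀ 𝒳 M))).trans
    (ConcreteCategory.congr_hom (F.obj.map_id (op (cover₀ 𝒳 M))) y)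

variable {𝒳} in
lemma evalEquiv_zero [ContravariantlyFinite 𝒳] (F : ModCat 𝒳) (Q : 𝒳.FullSubcategory)
    [Projective Q.obj] : evalEquiv F Q 0 = 0 :=
  (((thetaAdjR 𝒳).unit.app F).hom.app (op Q)).hom.map_zero

variable {𝒳} in
lemma kernel_ι_evalEquiv [ContravariantlyFinite 𝒳] {M : C} {F : ModCat 𝒳}
    (α : thetaLObj 𝒳 M ⟶ F) :
    kernel.ι (Projective.π M) ≫ evalEquiv F (cover₀ 𝒳 M) (genValueL α) = 0 := by
  apply (cancel_epi (Projective.π (kernel (Projective.π M)))).1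
  rw [comp_zero, ← Category.assoc]
  refine (evalEquiv_map F (coverD 𝒳 M) _).symm.trans ?_
  rw [map_genValueL, evalEquiv_zero]

variable {𝒳} in
lemma map_evalEquiv_symm [ContravariantlyFinite 𝒳] {M : C} {F : ModCat 𝒳}
    (f : M ⟶ (theta 𝒳).obj F) : F.obj.map (coverD 𝒳 M).op
      ((evalEquiv F (cover₀ 𝒳 M)).symm (Projective.π M ≫ f)) = 0 := by
  apply (evalEquiv F (cover₁ 𝒳 M)).injective
  rw [evalEquiv_map, Equiv.apply_symm_apply, evalEquiv_zero]
  simp [coverD]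

variable {𝒳} in
/-- The adjunction bijection between `ϑ_λ` and `ϑ`. -/
def thetaLHomEquiv [ContravariantlyFinite 𝒳] (M : C) (F : ModCat 𝒳) :
    (thetaLObj 𝒳 M ⟶ F) ≃ (M ⟶ (theta 𝒳).obj F) where
  toFun α := Abelian.epiDesc (Projective.π M) _ (kernel_ι_evalEquiv α)
  invFun f := thetaLDesc _ (map_evalEquiv_symm f)
  left_inv α := by
    apply genValueL_ext
    rw [genValueL_thetaLDesc, Equiv.symm_apply_eq]
    exact Abelian.comp_epiDesc _ _ _
  right_inv f := by
    apply (cancel_epi (Projective.π M)).1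
    rw [Abelian.comp_epiDesc, genValueL_thetaLDesc, Equiv.apply_symm_apply]

variable {𝒳} in
lemma thetaLHomEquiv_naturality [ContravariantlyFinite 𝒳] (M : C) (F G : ModCat 𝒳) (β : F ⟶ G)
    (α : thetaLObj 𝒳 M ⟶ F) :
    thetaLHomEquiv M G (α ≫ β) = thetaLHomEquiv M F α ≫ (theta 𝒳).map β := by
  apply (cancel_epi (Projective.π M)).1
  have h1 : Projective.π M ≫ thetaLHomEquiv M G (α ≫ β) =
    evalEquiv G (cover₀ 𝒳 M) (genValueL (α ≫ β)) := Abelian.comp_epiDesc _ _ _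
  have h2 : Projective.π M ≫ thetaLHomEquiv M F α =
    evalEquiv F (cover₀ 𝒳 M) (genValueL α) := Abelian.comp_epiDesc _ _ _
  rw [h1, ← Category.assoc, h2]
  exact evalEquiv_app β (cover₀ 𝒳 M) _

/-- The functor `ϑ_λ : C ⥤ mod-𝒳`. -/
def thetaL [ContravariantlyFinite 𝒳] : C ⥤ ModCat 𝒳 :=
  Adjunction.leftAdjointOfEquiv thetaLHomEquiv thetaLHomEquiv_naturality

/-- The adjunction `ϑ_λ ⊣ ϑ`. -/
def thetaAdjL [ContravariantlyFinite 𝒳] : thetaL 𝒳 ⊣ theta 𝒳 :=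
  Adjunction.adjunctionOfEquivLeft thetaLHomEquiv thetaLHomEquiv_naturality

instance [ContravariantlyFinite 𝒳] : (thetaR 𝒳).Faithful where
  map_injective {M N f g} h := by
    apply (cancel_epi (Projective.π M)).1
    exact congrArg (fun β => β.hom.app (op (cover₀ 𝒳 M)) (Projective.π M)) h

instance [ContravariantlyFinite 𝒳] : (thetaR 𝒳).Full where
  map_surjective {M N} α := by
    let a : ∀ Y : 𝒳.FullSubcategory, (Y.obj ⟶ M) → (Y.obj ⟶ N) := fun Y g => α.hom.app (op Y) g
    have key : ∀ {Y Z : 𝒳.FullSubcategory} (h : Z ⟶ Y) (g : Y.obj ⟶ M),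
        a Z (h.hom ≫ g) = h.hom ≫ a Y g := fun h g => naturality_apply α.hom h.op g
    have hzero : ∀ Z, a Z 0 = 0 := fun Z => (α.hom.app (op Z)).hom.map_zero
    have hker : kernel.ι (Projective.π M) ≫ a (cover₀ 𝒳 M) (Projective.π M) = 0 := by
      apply (cancel_epi (Projective.π (kernel (Projective.π M)))).1
      rw [comp_zero, ← Category.assoc]
      refine (key (coverD 𝒳 M) (Projective.π M)).symm.trans ?_
      have h0 : (coverD 𝒳 M).hom ≫ Projective.π M = 0 := by simp [coverD]
      rw [h0, hzero]
    refine ⟨Abelian.epiDesc (Projective.π M) _ hker, ?_⟩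
    apply ObjectProperty.hom_ext
    ext ⟨Y⟩ (g : Y.obj ⟶ M)
    change g ≫ Abelian.epiDesc (Projective.π M) _ hker = a Y g
    apply (cancel_epi (Projective.π Y.obj)).1
    obtain ⟨t, e⟩ : ∃ t, t ≫ Projective.π M = Projective.π Y.obj ≫ g :=
      ⟨Projective.factorThru _ _, Projective.factorThru_comp _ _⟩
    have k1 := key (Z := cover₀ 𝒳 Y.obj) (ObjectProperty.homMk (Projective.π Y.obj)) g
    have k2 := key (Z := cover₀ 𝒳 Y.obj) (Y := cover₀ 𝒳 M) (ObjectProperty.homMk t)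
      (Projective.π M)
    refine Eq.trans ?_ k1
    change _ = a (cover₀ 𝒳 Y.obj) (Projective.π Y.obj ≫ g)
    rw [← Category.assoc, ← e, Category.assoc, Abelian.comp_epiDesc]
    exact k2.symm

variable {𝒳} in
/-- `mod₀-𝒳`: the finitely presented functors that vanish at the object `G`. -/
def modZero (G : 𝒳.FullSubcategory) : ObjectProperty (ModCat 𝒳) :=
  fun F => IsZero (F.obj.obj (op G))

variable {𝒳} in
lemma modZero_iff [ContravariantlyFinite 𝒳] (G : 𝒳.FullSubcategory) [Projective G.obj]
    (hG : IsSeparator G.obj) (F : ModCat 𝒳) : modZero G F ↔ IsZero ((theta 𝒳).obj F) := by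
  constructor
  · intro h
    have h1 : Subsingleton (F.obj.obj (op G)) := AddCommGrpCat.subsingleton_of_isZero h
    have h2 : Subsingleton (G.obj ⟶ (theta 𝒳).obj F) := (evalEquiv F G).symm.subsingleton
    rw [IsZero.iff_id_eq_zero]
    exact hG.def _ _ (fun h => Subsingleton.elim _ _)
  · intro h
    have h2 : Subsingleton (G.obj ⟶ (theta 𝒳).obj F) := ⟨fun a b => h.eq_of_tgt a b⟩
    have h1 : Subsingleton (F.obj.obj (op G)) := (evalEquiv F G).subsingleton
    exact AddCommGrpCat.isZero_of_subsingleton _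

/-- The recollement of `mod-𝒳` by `mod₀-𝒳` and `C`. -/
def relRecollement [ContravariantlyFinite 𝒳] [𝒳.IsClosedUnderFiniteProducts]
    (G : 𝒳.FullSubcategory) [Projective G.obj] (hG : IsSeparator G.obj) :
    Recollement (modZero G).FullSubcategory (ModCat 𝒳) C :=
  Recollement.ofTriple (thetaAdjL 𝒳) (thetaAdjR 𝒳) (modZero_iff G hG)

end RelativeRecollement

section Modules

lemma isNoetherianRing_mulOpposite (k : Type w) [CommRing k] [IsArtinianRing k] (Λ : Type u)
    [Ring Λ] [Algebra k Λ] [Module.Finite k Λ] : IsNoetherianRing Λᵐᵒᵖ :=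
  IsNoetherianRing.of_finite k Λᵐᵒᵖ

variable {R : Type u} [Ring R]

lemma FGModuleCat_surjective_of_epi [IsNoetherianRing R] {M N : FGModuleCat.{u} R} (f : M ⟶ N)
    [Epi f] : Function.Surjective f.hom.hom := by
  have : Epi ((forget₂ (FGModuleCat R) (ModuleCat.{u} R)).map f) := inferInstance
  exact (ModuleCat.epi_iff_surjective _).1 this

lemma FGModuleCat_projective [IsNoetherianRing R] (P : FGModuleCat.{u} R) [Module.Projective R P] :
    Projective P where
  factors {E N} f e _ := by
    obtain ⟨h, hh⟩ := Module.projective_lifting_property e.hom.hom f.hom.hom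
      (FGModuleCat_surjective_of_epi e)
    exact ⟨FGModuleCat.ofHom h, FGModuleCat.hom_ext hh⟩

instance [IsNoetherianRing R] : EnoughProjectives (FGModuleCat.{u} R) where
  presentation M := by
    obtain ⟨n, f, hf⟩ := Module.Finite.exists_fin' R M
    have h : Epi (FGModuleCat.ofHom f) := ConcreteCategory.epi_of_surjective _ hf
    exact ⟨{ p := FGModuleCat.of R (Fin n → R)
             projective := FGModuleCat_projective _
             f := FGModuleCat.ofHom f
             epi := h }⟩

instance [IsNoetherianRing R] : Projective (FGModuleCat.of R R) := FGModuleCat_projective _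

lemma isSeparator_regular : IsSeparator (FGModuleCat.of R R) := by
  rw [isSeparator_def]
  intro M N f g h
  apply FGModuleCat.hom_ext
  ext x
  have h1 : f.hom.hom (LinearMap.toSpanSingleton R M x 1) =
      g.hom.hom (LinearMap.toSpanSingleton R M x 1) :=
    congrArg (fun t => t.hom.hom (1 : R))
      (h (FGModuleCat.ofHom (LinearMap.toSpanSingleton R M x)))
  rwa [LinearMap.toSpanSingleton_apply, one_smul] at h1

/-- `add X`: the finitely generated modules that are direct summands of `Xⁿ` for some `n`. -/
def addClosure (X : FGModuleCat.{u} R) : ObjectProperty (FGModuleCat.{u} R) := fun M =>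
  ∃ (n : ℕ) (i : M →ₗ[R] (Fin n → X)) (p : (Fin n → X) →ₗ[R] M), p ∘ₗ i = LinearMap.id

lemma addClosure_of_finite {X M : FGModuleCat.{u} R} {ι : Type} [Finite ι] (i : M →ₗ[R] (ι → X))
    (p : (ι → X) →ₗ[R] M) (h : p ∘ₗ i = LinearMap.id) : addClosure X M := by
  obtain ⟨n, ⟨e⟩⟩ := Finite.exists_equiv_fin ι
  refine ⟨n, (LinearEquiv.funCongrLeft R X e.symm).toLinearMap ∘ₗ i,
    p ∘ₗ (LinearEquiv.funCongrLeft R X e).toLinearMap, ?_⟩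
  ext x
  have h2 : LinearEquiv.funCongrLeft R X e (LinearEquiv.funCongrLeft R X e.symm (i x)) = i x := by
    funext j
    simp [LinearEquiv.funCongrLeft, LinearMap.funLeft]
  exact (congrArg p h2).trans (LinearMap.congr_fun h x)

lemma addClosure_self (X : FGModuleCat.{u} R) : addClosure X X :=
  addClosure_of_finite (ι := Unit) (LinearMap.pi fun _ => LinearMap.id) (LinearMap.proj ()) rfl

instance (X : FGModuleCat.{u} R) : (addClosure X).IsClosedUnderFiniteProducts where
  isClosedUnderLimitsOfShape J _ :=
    { limitsOfShape_le := by
        rintro M ⟨P⟩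
        choose n i p h using fun j : J => P.prop_diag_obj ⟨j⟩
        let c : Cone P.diag :=
          { pt := FGModuleCat.of R ((Σ j : J, Fin (n j)) → X)
            π := Discrete.natTrans fun j => FGModuleCat.ofHom
              (p j.as ∘ₗ LinearMap.funLeft R X (fun t => (⟨j.as, t⟩ : Σ j : J, Fin (n j)))) }
        let a : M →ₗ[R] ((Σ j : J, Fin (n j)) → X) :=
          LinearMap.pi fun s => LinearMap.proj s.2 ∘ₗ i s.1 ∘ₗ (P.π.app ⟨s.1⟩).hom.hom
        refine addClosure_of_finite a (P.isLimit.lift c).hom.hom ?_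
        have hid : (FGModuleCat.ofHom a : M ⟶ c.pt) ≫ P.isLimit.lift c = 𝟙 M := by
          apply P.isLimit.hom_ext
          rintro ⟨j⟩
          rw [Category.assoc, P.isLimit.fac]
          apply FGModuleCat.hom_ext
          ext m
          exact LinearMap.congr_fun (h j) ((P.π.app ⟨j⟩).hom.hom m)
        exact congrArg (fun t => t.hom.hom) hid }

/-- `⊥R`: the finitely generated modules `M` with `Extⁱ(M, R) = 0` for all `i > 0`. -/
def leftPerp (R : Type u) [Ring R] : ObjectProperty (FGModuleCat.{u} R) := fun M =>
  ∀ i : ℕ, 0 < i → Subsingleton (Abelian.Ext M.obj (ModuleCat.of R R) i)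

/-- `𝒳` is closed under syzygies: for every short exact sequence `0 ⟶ K ⟶ P ⟶ M ⟶ 0` of finitely
generated modules with `P` projective and `M` in `𝒳`, the module `K` is in `𝒳`. -/
def ClosedUnderSyzygies (𝒳 : ObjectProperty (FGModuleCat.{u} R)) : Prop :=
  ∀ S : ShortComplex (FGModuleCat.{u} R), S.ShortExact → Projective S.X₂ → 𝒳 S.X₃ → 𝒳 S.X₁

/-- The module `R`, regarded as an object of a subcategory `𝒳` that contains the projectives. -/
def regular [IsNoetherianRing R] (𝒳 : ObjectProperty (FGModuleCat.{u} R))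
    [ContainsProjectives 𝒳] : 𝒳.FullSubcategory :=
  ofProjective (FGModuleCat.of R R)

instance [IsNoetherianRing R] (𝒳 : ObjectProperty (FGModuleCat.{u} R)) [ContainsProjectives 𝒳] :
    Projective (regular 𝒳).obj :=
  inferInstanceAs (Projective (FGModuleCat.of R R))

/-- The recollement of `mod-𝒳` by `mod₀-𝒳` (the functors vanishing at `R`) and the category of
finitely generated `R`-modules. -/
def moduleRecollement [IsNoetherianRing R] (𝒳 : ObjectProperty (FGModuleCat.{u} R))
    [ContravariantlyFinite 𝒳] [ContainsProjectives 𝒳] [𝒳.IsClosedUnderFiniteProducts] :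
    Recollement (modZero (regular 𝒳)).FullSubcategory (ModCat 𝒳) (FGModuleCat.{u} R) :=
  relRecollement 𝒳 (regular 𝒳) isSeparator_regular

/-- The `𝒳`-intermediate extension functor. -/
def intermediateExtension [IsNoetherianRing R] (𝒳 : ObjectProperty (FGModuleCat.{u} R))
    [ContravariantlyFinite 𝒳] [ContainsProjectives 𝒳] [𝒳.IsClosedUnderFiniteProducts] :
    FGModuleCat.{u} R ⥤ ModCat 𝒳 :=
  (moduleRecollement 𝒳).ζ

/-- A linear endomorphism of `X`, as a morphism of `𝒳`. -/
def endHom {𝒳 : ObjectProperty (FGModuleCat.{u} R)} {X : 𝒳.FullSubcategory}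
    (f : Module.End R X.obj) : X ⟶ X :=
  ObjectProperty.homMk (ObjectProperty.homMk (ModuleCat.ofHom f))

/-- The right `End(X)`-module structure on `F(X)`, given by `y * f = F(f)(y)`; right modules over
a ring are left modules over the opposite ring. -/
instance [IsNoetherianRing R] {𝒳 : ObjectProperty (FGModuleCat.{u} R)} (X : 𝒳.FullSubcategory) (F : ModCat 𝒳) :
    Module (Module.End R X.obj)ᵐᵒᵖ (F.obj.obj (op X)) where
  smul f y := F.obj.map (endHom f.unop).op y
  one_smul y := ConcreteCategory.congr_hom (F.obj.map_id (op X)) y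
  mul_smul f g y := ConcreteCategory.congr_hom
    (F.obj.map_comp (endHom g.unop).op (endHom f.unop).op) y
  smul_zero f := (F.obj.map (endHom f.unop).op).hom.map_zero
  smul_add f := (F.obj.map (endHom f.unop).op).hom.map_add
  zero_smul y := by
    change F.obj.map (endHom (0 : Module.End R X.obj)).op y = 0
    have h : (endHom (0 : Module.End R X.obj) : X ⟶ X) = 0 := rfl
    rw [h, op_zero, F.obj.map_zero]
    rfl
  add_smul f g y := by
    change F.obj.map (endHom (f.unop + g.unop)).op y = _
    have h : (endHom (f.unop + g.unop) : X ⟶ X) = endHom f.unop + endHom g.unop := rfl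
    rw [h, op_add, F.obj.map_add]
    rfl

/-- Evaluation at `X`, as a functor from `mod-𝒳` to right `End(X)`-modules. -/
def evaluationAt [IsNoetherianRing R] {𝒳 : ObjectProperty (FGModuleCat.{u} R)} (X : 𝒳.FullSubcategory) :
    ModCat 𝒳 ⥤ ModuleCat.{u} (Module.End R X.obj)ᵐᵒᵖ where
  obj F := ModuleCat.of _ (F.obj.obj (op X))
  map α := ModuleCat.ofHom
    { toFun := α.hom.app (op X)
      map_add' := (α.hom.app (op X)).hom.map_add
      map_smul' := fun f y => naturality_apply α.hom (endHom f.unop).op y }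

/-- The relative Auslander algebra `End(X)` of `add X`. -/
abbrev Aus (X : FGModuleCat.{u} R) : Type u := Module.End R X

/-- The right `Aus(addClosure X)`-module `ζ_X(X)`: the value at `X` of the intermediate extension of
`X`. -/
def zetaModule [IsNoetherianRing R] (X : FGModuleCat.{u} R) [ContravariantlyFinite (addClosure X)]
    [ContainsProjectives (addClosure X)] : ModuleCat.{u} (Aus X)ᵐᵒᵖ :=
  (evaluationAt (⟨X, addClosure_self X⟩ : (addClosure X).FullSubcategory)).obj
    ((intermediateExtension (addClosure X)).obj X)

end Modules

section Tilting

/-- A module is indecomposable if it is nonzero and not a direct sum of two nonzero submodules. -/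
def IsIndecomposable (R : Type u) [Ring R] (M : Type v) [AddCommGroup M] [Module R M] : Prop :=
  Nontrivial M ∧ ∀ N N' : Submodule R M, IsCompl N N' → N = ⊥ ∨ N' = ⊥

/-- The indecomposable direct summands of `M`. -/
def IndecSummand (R : Type u) [Ring R] (M : Type v) [AddCommGroup M] [Module R M] : Type v :=
  {N : Submodule R M // IsComplemented N ∧ IsIndecomposable R N}

/-- Isomorphism of indecomposable direct summands. -/
def indecSummandSetoid (R : Type u) [Ring R] (M : Type v) [AddCommGroup M] [Module R M] :
    Setoid (IndecSummand R M) where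
  r N N' := Nonempty (N.1 ≃ₗ[R] N'.1)
  iseqv := ⟨fun _ => ⟨LinearEquiv.refl _ _⟩, fun ⟨e⟩ => ⟨e.symm⟩, fun ⟨e⟩ ⟨e'⟩ => ⟨e.trans e'⟩⟩

/-- The number of indecomposable direct summands of `M` up to isomorphism. -/
def numIndecSummands (R : Type u) [Ring R] (M : Type v) [AddCommGroup M] [Module R M] : ℕ∞ :=
  ENat.card (Quotient (indecSummandSetoid R M))

/-- Tilting modules: finitely generated rigid modules of projective dimension at most one with as
many indecomposable direct summands up to isomorphism as the regular module. -/
structure IsTilting (R : Type u) [Ring R] (T : ModuleCat.{u} R) : Prop where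
  finite : Module.Finite R T
  projectiveDimension_le : HasProjectiveDimensionLE T 1
  rigid : Subsingleton (Abelian.Ext T T 1)
  card_summands : numIndecSummands R T = numIndecSummands R R

/-- Cotilting modules: finitely generated rigid modules of injective dimension at most one with as
many indecomposable direct summands up to isomorphism as the regular module. -/
structure IsCotilting (R : Type u) [Ring R] (T : ModuleCat.{u} R) : Prop where
  finite : Module.Finite R T
  injectiveDimension_le : HasInjectiveDimensionLE T 1
  rigid : Subsingleton (Abelian.Ext T T 1)
  card_summands : numIndecSummands R T = numIndecSummands R R

end Tilting

end

end RelAus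

/-! Write `Γ` for the endomorphism ring of `X` and let `π : Q ⟶ X` be the chosen epimorphism from a
projective. The component of `γ` at `X` sends the generator of `ϑ_λ X` to `π`, so its image,
evaluated at `X`, is the right ideal of `Γ` formed by the endomorphisms that factor through `π`
(`exists_zetaι_eq_iff`, `isFactorIdeal_zetaModuleι`). The predicate `IsFactorIdeal` records this
description, and the homological algebra uses nothing else about `T`.

Put `K = ker π`. Then `0 ⟶ Hom(X, K) ⟶ Hom(X, Q) ⟶ T ⟶ 0` is exact (`exists_shortExact`). Both `Q`
and `K` lie in `add X`, the latter by closure under syzygies, so the first two terms are projective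
over `Γ` and `T` has projective dimension at most one. A map `Hom(X, K) ⟶ T` is composition with `π
∘ v` for some `v : K ⟶ Q` (`exists_eq_comp`). Since `Ext¹(X, Λ) = 0`, `v` extends to `Q`, hence the
map extends to `Hom(X, Q)`, and `Ext¹(T, T) = 0`.

For the count, left multiplication identifies `Γ` with the endomorphism ring of `T`
(`nonempty_end_ringEquiv`). The number of isomorphism classes of indecomposable summands is a count
of primitive idempotents up to equivalence, so it depends only on the endomorphism ring
(`numIndecSummands_eq_of_ringEquiv`), and that ring is `Γ` for the regular module too.

For the injective dimension, embed `T` in an injective `E` and test `C = E / T` by Baer's criterion.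
Generators of a right ideal `I` form a morphism `d : Xⁿ ⟶ X`, and the relations among them are
`Hom(X, ker d)`. Closure under submodules puts `ker d ⊆ Xⁿ` and `Xⁿ / ker d ⊆ X` in `add X`, so the
extension argument used for rigidity applies to `ker d ⊆ Xⁿ` and lets maps `I ⟶ C` lift to `E`
(`exists_extend`). -/

namespace RelAus

/-! ### Indecomposable summands and primitive idempotents -/

section Idempotents

/-- An idempotent is primitive if it is nonzero and is not a sum of two nonzero orthogonal
idempotents. -/
def IsPrimitiveIdempotent {E : Type u} [Ring E] (e : E) : Prop :=
  e * e = e ∧ e ≠ 0 ∧ ∀ f : E, f * f = f → e * f = f → f * e = f → f = 0 ∨ f = e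

lemma IsPrimitiveIdempotent.map {E : Type u} [Ring E] {E' : Type v} [Ring E'] (φ : E ≃+* E')
    {e : E} (he : IsPrimitiveIdempotent e) : IsPrimitiveIdempotent (φ e) := by
  obtain ⟨h1, h2, h3⟩ := he
  refine ⟨by rw [← map_mul, h1], by simpa using h2, fun f hf hef hfe => ?_⟩
  obtain ⟨f, rfl⟩ := φ.surjective f
  rw [← map_mul, φ.injective.eq_iff] at hf hef hfe
  rcases h3 f hf hef hfe with h | h
  · exact Or.inl (by rw [h, map_zero])
  · exact Or.inr (by rw [h])

/-- Equivalence of idempotents: `e = a b` and `f = b a` for some `a ∈ e E f` and `b ∈ f E e`. -/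
def IdempotentEquiv {E : Type u} [Ring E] (e f : E) : Prop :=
  ∃ a b : E, e * a = a ∧ a * f = a ∧ f * b = b ∧ b * e = b ∧ a * b = e ∧ b * a = f

lemma IdempotentEquiv.map {E : Type u} [Ring E] {E' : Type v} [Ring E'] (φ : E ≃+* E')
    {e f : E} (h : IdempotentEquiv e f) : IdempotentEquiv (φ e) (φ f) := by
  obtain ⟨a, b, h1, h2, h3, h4, h5, h6⟩ := h
  refine ⟨φ a, φ b, ?_, ?_, ?_, ?_, ?_, ?_⟩ <;> rw [← map_mul] <;> congr 1

variable {R : Type u} [Ring R] {M : Type v} [AddCommGroup M] [Module R M]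

lemma apply_of_mem_range {e : Module.End R M} (he : e * e = e) {x : M}
    (hx : x ∈ LinearMap.range e) : e x = x := by
  obtain ⟨y, rfl⟩ := hx
  exact LinearMap.congr_fun he y

/-- A splitting of the image of `e` yields an idempotent `f` of `eEe`, the projection onto one part.
The cases `f = 0` and `f = e` kill one part or the other. -/
lemma isIndecomposable_range {e : Module.End R M} (he : IsPrimitiveIdempotent e) :
    IsIndecomposable R (LinearMap.range e) := by
  obtain ⟨h1, h2, h3⟩ := he
  refine ⟨?_, fun N N' h => ?_⟩
  · rw [Submodule.nontrivial_iff_ne_bot, Ne, LinearMap.range_eq_bot]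
    exact h2
  · let f : Module.End R M := (LinearMap.range e).subtype ∘ₗ N.projection N' h ∘ₗ e.rangeRestrict
    have hfe : f * e = f := by
      ext x
      change ((N.projection N' h (e.rangeRestrict (e x)) : LinearMap.range e) : M) =
        N.projection N' h (e.rangeRestrict x)
      congr 2
      ext
      exact LinearMap.congr_fun h1 x
    have hef : e * f = f := by
      ext x
      exact apply_of_mem_range h1 (Subtype.property _)
    have hr : ∀ y : LinearMap.range e, f y = N.projection N' h y := fun y => by
      change ((N.projection N' h (e.rangeRestrict y) : LinearMap.range e) : M) = _
      congr 2
      ext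
      exact apply_of_mem_range h1 y.2
    have hff : f * f = f := by
      ext x
      change f (N.projection N' h (e.rangeRestrict x)) = N.projection N' h (e.rangeRestrict x)
      rw [hr]
      congr 1
      exact LinearMap.congr_fun (N.isIdempotentElem_projection h) _
    rcases h3 f hff hef hfe with h0 | h0
    · left
      rw [eq_bot_iff]
      intro y hy
      have h4 := hr y
      rw [h0, N.projection_apply_of_mem_left h hy] at h4
      exact Subtype.ext h4.symm
    · right
      rw [eq_bot_iff]
      intro y hy
      have h4 := hr y
      rw [h0, (N.projection_apply_eq_zero_iff h).2 hy, apply_of_mem_range h1 y.2] at h4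
      exact Subtype.ext h4

/-- An idempotent `f` of `eEe` restricts to an idempotent of the image of `e`, whose range and
kernel are complementary, so one of them vanishes. -/
lemma isPrimitiveIdempotent_of_isIndecomposable_range {e : Module.End R M} (h1 : e * e = e)
    (h : IsIndecomposable R (LinearMap.range e)) : IsPrimitiveIdempotent e := by
  refine ⟨h1, ?_, fun f hff hef hfe => ?_⟩
  · have := h.1
    rwa [Submodule.nontrivial_iff_ne_bot, Ne, LinearMap.range_eq_bot] at this
  · have hf : ∀ x, f (f x) = f x := LinearMap.congr_fun hff
    have hfe' : ∀ x, f (e x) = f x := LinearMap.congr_fun hfe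
    have hef' : ∀ x, e (f x) = f x := LinearMap.congr_fun hef
    let g : Module.End R (LinearMap.range e) :=
      LinearMap.codRestrict _ (f ∘ₗ (LinearMap.range e).subtype) fun x => ⟨f x, hef' _⟩
    have hg : IsIdempotentElem g := by
      ext x
      exact hf x
    rcases h.2 _ _ (LinearMap.IsIdempotentElem.isCompl hg) with h0 | h0
    · left
      ext x
      have h4 := LinearMap.congr_fun (LinearMap.range_eq_bot.1 h0) ⟨e x, x, rfl⟩
      exact (hfe' x).symm.trans (congrArg Subtype.val h4)
    · right
      ext x
      -- The elements `(e - f) x` lie in the kernel of the restriction of `f`, so a trivial kernel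
      -- forces `f = e`.
      have h4 : (⟨e x - f x, x - f x, by rw [map_sub, hef']⟩ : LinearMap.range e) ∈
          LinearMap.ker g := by
        apply Subtype.ext
        change f (e x - f x) = 0
        rw [map_sub, hfe', hf, sub_self]
      rw [h0] at h4
      exact (sub_eq_zero.1 (congrArg Subtype.val h4 : e x - f x = 0)).symm

/-- The elements `a` and `b` restrict to mutually inverse maps between the images; conversely, an
isomorphism and its inverse are extended to `M` by precomposing with the idempotents. -/
lemma idempotentEquiv_iff {e f : Module.End R M} (he : e * e = e) (hf : f * f = f) :
    IdempotentEquiv e f ↔ Nonempty (LinearMap.range e ≃ₗ[R] LinearMap.range f) := by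
  constructor
  · rintro ⟨a, b, h1, h2, h3, h4, h5, h6⟩
    have h1' : ∀ x, e (a x) = a x := LinearMap.congr_fun h1
    have h3' : ∀ x, f (b x) = b x := LinearMap.congr_fun h3
    refine ⟨LinearEquiv.ofLinearMap
      (LinearMap.codRestrict _ (b ∘ₗ (LinearMap.range e).subtype) fun x => ⟨b x, h3' _⟩)
      (LinearMap.codRestrict _ (a ∘ₗ (LinearMap.range f).subtype) fun x => ⟨a x, h1' _⟩) ?_ ?_⟩
    · ext x
      exact (LinearMap.congr_fun h6 (x : M)).trans (apply_of_mem_range hf x.2)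
    · ext x
      exact (LinearMap.congr_fun h5 (x : M)).trans (apply_of_mem_range he x.2)
  · rintro ⟨t⟩
    have ht : ∀ x : LinearMap.range e, f.rangeRestrict (t x) = t x := fun x =>
      Subtype.ext (apply_of_mem_range hf (t x).2)
    have ht' : ∀ x : LinearMap.range f, e.rangeRestrict (t.symm x) = t.symm x := fun x =>
      Subtype.ext (apply_of_mem_range he (t.symm x).2)
    have hee : ∀ x, e.rangeRestrict (e x) = e.rangeRestrict x := fun x =>
      Subtype.ext (LinearMap.congr_fun he x)
    have hff : ∀ x, f.rangeRestrict (f x) = f.rangeRestrict x := fun x =>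
      Subtype.ext (LinearMap.congr_fun hf x)
    refine ⟨(LinearMap.range e).subtype ∘ₗ t.symm.toLinearMap ∘ₗ f.rangeRestrict,
      (LinearMap.range f).subtype ∘ₗ t.toLinearMap ∘ₗ e.rangeRestrict, ?_, ?_, ?_, ?_, ?_, ?_⟩
    · ext x
      exact apply_of_mem_range he (Subtype.property _)
    · ext x
      exact congrArg (fun y => (t.symm y : M)) (hff x)
    · ext x
      exact apply_of_mem_range hf (Subtype.property _)
    · ext x
      exact congrArg (fun y => (t y : M)) (hee x)
    · ext x
      change (t.symm (f.rangeRestrict (t (e.rangeRestrict x))) : M) = e x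
      rw [ht, LinearEquiv.symm_apply_apply]
      rfl
    · ext x
      change (t (e.rangeRestrict (t.symm (f.rangeRestrict x))) : M) = f x
      rw [ht', LinearEquiv.apply_symm_apply]
      rfl

lemma IndecSummand.exists_idempotent (N : IndecSummand R M) :
    ∃ e : Module.End R M, IsPrimitiveIdempotent e ∧ LinearMap.range e = N.1 := by
  obtain ⟨N', h⟩ := N.2.1
  have h1 : LinearMap.range (N.1.projection N' h) = N.1 := N.1.range_projection h
  refine ⟨N.1.projection N' h, isPrimitiveIdempotent_of_isIndecomposable_range
    (N.1.isIdempotentElem_projection h) ?_, h1⟩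
  rw [h1]
  exact N.2.2

/-- The image of a primitive idempotent endomorphism, as an indecomposable direct summand. -/
def IndecSummand.ofIdempotent (e : Module.End R M) (he : IsPrimitiveIdempotent e) :
    IndecSummand R M :=
  ⟨LinearMap.range e, ⟨_, LinearMap.IsIdempotentElem.isCompl he.1⟩, isIndecomposable_range he⟩

/-- Each summand is the image of a chosen primitive idempotent, which is transported along `φ`.
Primitivity and equivalence of idempotents are purely ring-theoretic, so this is well defined and
injective on isomorphism classes. -/
lemma numIndecSummands_le_of_ringEquiv {R' : Type u₁} [Ring R'] {M' : Type v₁} [AddCommGroup M']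
    [Module R' M'] (φ : Module.End R M ≃+* Module.End R' M') :
    numIndecSummands R M ≤ numIndecSummands R' M' := by
  choose e he hr using IndecSummand.exists_idempotent (R := R) (M := M)
  have key : ∀ N N' : IndecSummand R M, Nonempty (N.1 ≃ₗ[R] N'.1) ↔
      Nonempty (LinearMap.range (φ (e N)) ≃ₗ[R'] LinearMap.range (φ (e N'))) := by
    intro N N'
    rw [← idempotentEquiv_iff ((he N).map φ).1 ((he N').map φ).1, ← hr N, ← hr N',
      ← idempotentEquiv_iff (he N).1 (he N').1]
    refine ⟨fun h => h.map φ, fun h => ?_⟩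
    simpa using h.map φ.symm
  refine ENat.card_le_card_of_injective (f := Quotient.map
    (sa := indecSummandSetoid R M) (sb := indecSummandSetoid R' M')
    (fun N => IndecSummand.ofIdempotent (φ (e N)) ((he N).map φ)) fun N N' h => (key N N').1 h) ?_
  intro a b
  induction a using Quotient.inductionOn
  induction b using Quotient.inductionOn
  intro h
  exact Quotient.sound ((key _ _).2 (Quotient.exact h))

/-- The number of indecomposable direct summands only depends on the endomorphism ring. -/
lemma numIndecSummands_eq_of_ringEquiv {R' : Type u₁} [Ring R'] {M' : Type v₁} [AddCommGroup M']
    [Module R' M'] (φ : Module.End R M ≃+* Module.End R' M') :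
    numIndecSummands R M = numIndecSummands R' M' :=
  le_antisymm (numIndecSummands_le_of_ringEquiv φ) (numIndecSummands_le_of_ringEquiv φ.symm)

end Idempotents

/-! ### `Ext¹` as the obstruction to extending morphisms -/

section Extensions

variable {C : Type u} [Category.{v} C] [Abelian C] [HasExt.{w} C]

/-- As the middle term is projective, every class comes from some `f : S.X₁ ⟶ Y` through the
connecting map, and this map kills morphisms that extend to `S.X₂`. -/
lemma subsingleton_ext_one_of_extend {S : ShortComplex C} (hS : S.ShortExact) [Projective S.X₂]
    {Y : C} (h : ∀ f : S.X₁ ⟶ Y, ∃ g : S.X₂ ⟶ Y, S.f ≫ g = f) :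
    Subsingleton (Abelian.Ext S.X₃ Y 1) := by
  refine subsingleton_of_forall_eq 0 fun x => ?_
  obtain ⟨y, rfl⟩ := Abelian.Ext.contravariant_sequence_exact₃ hS Y x
    (Abelian.Ext.eq_zero_of_projective _) (add_zero 1)
  obtain ⟨f, rfl⟩ := Abelian.Ext.addEquiv₀.symm.surjective y
  obtain ⟨g, rfl⟩ := h f
  simp only [Abelian.Ext.addEquiv₀_symm_apply]
  rw [← Abelian.Ext.mk₀_comp_mk₀, hS.extClass_comp_assoc]

/-- The obstruction to extending `f` is its product with the extension class, an element of the
vanishing group. -/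
lemma exists_extend_of_subsingleton_ext_one {S : ShortComplex C} (hS : S.ShortExact) {Y : C}
    (h : Subsingleton (Abelian.Ext S.X₃ Y 1)) (f : S.X₁ ⟶ Y) : ∃ g : S.X₂ ⟶ Y, S.f ≫ g = f := by
  obtain ⟨y, hy⟩ := Abelian.Ext.contravariant_sequence_exact₁ hS Y (Abelian.Ext.mk₀ f) (add_zero 1)
    (Subsingleton.elim _ _)
  obtain ⟨g, rfl⟩ := Abelian.Ext.addEquiv₀.symm.surjective y
  refine ⟨g, Abelian.Ext.addEquiv₀.symm.injective ?_⟩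
  simpa using hy

variable {R : Type u} [Ring R]

/-- The short exact sequence given by a submodule and its quotient. -/
lemma shortExact_submodule {Y : Type u} [AddCommGroup Y] [Module R Y] (K : Submodule R Y) :
    (ShortComplex.mk (ModuleCat.ofHom K.subtype) (ModuleCat.ofHom K.mkQ)
      (by ext x; simp)).ShortExact where
  exact := (ShortComplex.ShortExact.moduleCat_exact_iff_function_exact _).2
    (LinearMap.exact_subtype_mkQ K)
  mono_f := (ModuleCat.mono_iff_injective _).2 K.injective_subtype
  epi_g := (ModuleCat.epi_iff_surjective _).2 K.mkQ_surjective

/-- Since `Q` is a direct summand of some `Rⁿ`, it suffices to extend each coordinate, a map to `R`,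
and to project back to `Q`. -/
lemma exists_extend_to_projective {Y Q : Type u} [AddCommGroup Y] [Module R Y]
    [AddCommGroup Q] [Module R Q] [Module.Finite R Q] [Module.Projective R Q] (K : Submodule R Y)
    (h : Subsingleton (Abelian.Ext (ModuleCat.of R (Y ⧸ K)) (ModuleCat.of R R) 1))
    (v : K →ₗ[R] Q) : ∃ v' : Y →ₗ[R] Q, v' ∘ₗ K.subtype = v := by
  obtain ⟨n, p, i, -, -, hpi⟩ := Module.Finite.exists_comp_eq_id_of_projective R Q
  choose g hg using fun j : Fin n => exists_extend_of_subsingleton_ext_one (shortExact_submodule K)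
    h (ModuleCat.ofHom (LinearMap.proj j ∘ₗ i ∘ₗ v))
  have hg' : ∀ (j : Fin n) (x : K), (g j).hom (x : Y) = i (v x) j := fun j x =>
    LinearMap.congr_fun (congrArg ModuleCat.Hom.hom (hg j)) x
  refine ⟨p ∘ₗ LinearMap.pi fun j => (g j).hom, ?_⟩
  ext x
  refine Eq.trans ?_ (LinearMap.congr_fun hpi (v x))
  change p (fun j => (g j).hom (x : Y)) = p (i (v x))
  congr 1
  funext j
  exact hg' j x

end Extensions

/-! ### The `End(X)`-modules `Hom(X, M)` for `M` in `add X` -/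

section HomModules

variable (R : Type u) [Ring R] (X M : Type u) [AddCommGroup X] [Module R X]
  [AddCommGroup M] [Module R M]

/-- `Hom(X, M)`, regarded as a right module over `End(X)`. -/
def HomModule : Type u := X →ₗ[R] M

instance : AddCommGroup (HomModule R X M) := inferInstanceAs (AddCommGroup (X →ₗ[R] M))

instance : Module (Module.End R X)ᵐᵒᵖ (HomModule R X M) where
  smul f g := LinearMap.comp g f.unop
  one_smul _ := LinearMap.comp_id _
  mul_smul _ _ _ := rfl
  smul_zero _ := LinearMap.zero_comp _
  smul_add _ _ _ := LinearMap.add_comp _ _ _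
  zero_smul _ := LinearMap.comp_zero _
  add_smul _ _ _ := LinearMap.comp_add _ _ _

variable {R X M}

/-- The map `Hom(X, M) ⟶ End(X)ⁿ` induced by a morphism `M ⟶ Xⁿ`. -/
def homModuleToFree {n : ℕ} (i : M →ₗ[R] (Fin n → X)) :
    HomModule R X M →ₗ[(Module.End R X)ᵐᵒᵖ] (Fin n → (Module.End R X)ᵐᵒᵖ) where
  toFun w j := MulOpposite.op (LinearMap.proj j ∘ₗ i ∘ₗ w)
  map_add' (w w' : X →ₗ[R] M) := by
    funext j
    apply MulOpposite.unop_injective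
    ext x
    exact congrFun (i.map_add (w x) (w' x)) j
  map_smul' f w := rfl

/-- The map `End(X)ⁿ ⟶ Hom(X, M)` induced by a morphism `Xⁿ ⟶ M`. -/
def homModuleOfFree {n : ℕ} (p : (Fin n → X) →ₗ[R] M) :
    (Fin n → (Module.End R X)ᵐᵒᵖ) →ₗ[(Module.End R X)ᵐᵒᵖ] HomModule R X M where
  toFun a := p ∘ₗ LinearMap.pi fun j => (a j).unop
  map_add' a b := by
    apply LinearMap.ext
    intro x
    exact p.map_add (fun j => (a j).unop x) (fun j => (b j).unop x)
  map_smul' f a := rfl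

lemma homModuleOfFree_comp {n : ℕ} {i : M →ₗ[R] (Fin n → X)} {p : (Fin n → X) →ₗ[R] M}
    (h : p ∘ₗ i = LinearMap.id) : homModuleOfFree p ∘ₗ homModuleToFree i = LinearMap.id := by
  apply LinearMap.ext
  intro (w : X →ₗ[R] M)
  apply LinearMap.ext
  intro x
  exact LinearMap.congr_fun h (w x)

lemma homModule_projective {n : ℕ} {i : M →ₗ[R] (Fin n → X)} {p : (Fin n → X) →ₗ[R] M}
    (h : p ∘ₗ i = LinearMap.id) : Module.Projective (Module.End R X)ᵐᵒᵖ (HomModule R X M) :=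
  Module.Projective.of_split _ _ (homModuleOfFree_comp h)

lemma homModule_finite {n : ℕ} {i : M →ₗ[R] (Fin n → X)} {p : (Fin n → X) →ₗ[R] M}
    (h : p ∘ₗ i = LinearMap.id) : Module.Finite (Module.End R X)ᵐᵒᵖ (HomModule R X M) :=
  Module.Finite.of_surjective (homModuleOfFree p) fun w =>
    ⟨homModuleToFree i w, LinearMap.congr_fun (homModuleOfFree_comp h) w⟩

/-- The `j`-th component of a morphism `Xⁿ ⟶ M`. -/
def component {n : ℕ} (p : (Fin n → X) →ₗ[R] M) (j : Fin n) : HomModule R X M :=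
  p ∘ₗ LinearMap.single R (fun _ => X) j

/-- The components of `p` generate `Hom(X, M)`, so a linear map out of it is determined by finitely
many values. The coefficients are the coordinates of `i ∘ w`. -/
lemma homModule_eq_sum {n : ℕ} {i : M →ₗ[R] (Fin n → X)} {p : (Fin n → X) →ₗ[R] M}
    (h : p ∘ₗ i = LinearMap.id) (w : HomModule R X M) :
    w = ∑ j, homModuleToFree i w j • component p j := by
  have h1 : homModuleOfFree p (homModuleToFree i w) = w :=
    LinearMap.congr_fun (homModuleOfFree_comp h) w
  conv_lhs => rw [← h1, pi_eq_sum_univ' (homModuleToFree i w), map_sum]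
  refine Finset.sum_congr rfl fun j _ => ?_
  rw [map_smul]
  congr 1
  apply LinearMap.ext
  intro x
  change p _ = p _
  congr 1
  funext k
  by_cases hk : k = j
  · subst hk
    simp
  · simp [hk]

/-- A morphism out of `M ∈ add X` vanishes if it vanishes on all morphisms `X ⟶ M`. -/
lemma eq_zero_of_forall_comp {N : Type u} [AddCommGroup N] [Module R N] {n : ℕ}
    {i : M →ₗ[R] (Fin n → X)} {p : (Fin n → X) →ₗ[R] M} (h : p ∘ₗ i = LinearMap.id)
    {g : M →ₗ[R] N} (hg : ∀ w : X →ₗ[R] M, g ∘ₗ w = 0) : g = 0 := by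
  have h1 : g ∘ₗ p = 0 := LinearMap.pi_ext' fun j => by
    rw [LinearMap.zero_comp, LinearMap.comp_assoc]
    exact hg _
  rw [← LinearMap.comp_id g, ← h, ← LinearMap.comp_assoc, h1, LinearMap.zero_comp]

end HomModules

/-! ### The ideal of endomorphisms factoring through `π`, and its endomorphism ring -/

section TraceIdeal

variable {R : Type u} [Ring R] {X Q : Type u} [AddCommGroup X] [Module R X]
  [AddCommGroup Q] [Module R Q] {T : Type u} [AddCommGroup T] [Module (Module.End R X)ᵐᵒᵖ T]
  (π : Q →ₗ[R] X) (ι : T →ₗ[(Module.End R X)ᵐᵒᵖ] Module.End R X)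

/-- `ι` identifies `T` with the right ideal of all endomorphisms of `X` that factor
through `π`. -/
structure IsFactorIdeal : Prop where
  injective : Function.Injective ι
  exists_factor : ∀ t, ∃ g : X →ₗ[R] Q, π ∘ₗ g = ι t
  exists_preimage : ∀ g : X →ₗ[R] Q, ∃ t, ι t = π ∘ₗ g

variable {π ι}

namespace IsFactorIdeal

variable (H : IsFactorIdeal π ι)
include H

/-- A map `Hom(X, K) ⟶ T` with `K ∈ add X` is given by a morphism `K ⟶ X` that factors
through `π`. -/
lemma exists_eq_comp {K : Type u} [AddCommGroup K] [Module R K] {n : ℕ}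
    {i : K →ₗ[R] (Fin n → X)} {p : (Fin n → X) →ₗ[R] K} (h : p ∘ₗ i = LinearMap.id)
    (φ : HomModule R X K →ₗ[(Module.End R X)ᵐᵒᵖ] T) :
    ∃ v : K →ₗ[R] Q, ∀ w : X →ₗ[R] K, ι (φ w) = π ∘ₗ v ∘ₗ w := by
  -- Only the images of the finitely many generators are lifted through `π`, so the arbitrary choice
  -- of lifts causes no problem with linearity.
  choose g hg using fun j => H.exists_factor (φ (component p j))
  refine ⟨∑ j, g j ∘ₗ LinearMap.proj j ∘ₗ i, fun w => ?_⟩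
  conv_lhs => rw [homModule_eq_sum h w, map_sum, map_sum]
  have h1 : ∀ j, ι (φ (homModuleToFree i w j • component p j)) =
      π ∘ₗ g j ∘ₗ LinearMap.proj j ∘ₗ i ∘ₗ w := fun j => by
    rw [map_smul, map_smul, ← hg]
    rfl
  ext x
  simp only [h1, LinearMap.sum_apply, LinearMap.comp_apply, map_sum]

/-- The projection `Hom(X, Q) ⟶ T`. -/
lemma exists_projection : ∃ q : HomModule R X Q →ₗ[(Module.End R X)ᵐᵒᵖ] T,
    ∀ g : X →ₗ[R] Q, ι (q g) = π ∘ₗ g := by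
  -- Linearity of the chosen preimages follows from their uniqueness, that is, from the injectivity
  -- of `ι`.
  choose q hq using H.exists_preimage
  refine ⟨⟨⟨q, fun g g' => H.injective ?_⟩, fun f g => H.injective ?_⟩, hq⟩
  · refine (hq _).trans (Eq.trans ?_ (map_add ι _ _).symm)
    exact (LinearMap.comp_add _ _ _).trans (congrArg₂ (· + ·) (hq g) (hq g')).symm
  · refine (hq _).trans (Eq.trans ?_ (map_smul ι f (q g)).symm)
    exact (congrArg (f • ·) (hq g)).symm

/-- Left multiplication by an endomorphism of `X` preserves `T`. -/
lemma exists_mul_eq (g : Module.End R X) (hg : ∀ w : X →ₗ[R] Q, ∃ w', π ∘ₗ w' = g ∘ₗ π ∘ₗ w) :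
    ∃ φ : Module.End (Module.End R X)ᵐᵒᵖ T, ∀ t, ι (φ t) = g * ι t := by
  have h1 : ∀ t, ∃ t', ι t' = g * ι t := fun t => by
    obtain ⟨w, hw⟩ := H.exists_factor t
    obtain ⟨w', hw'⟩ := hg w
    obtain ⟨t', ht'⟩ := H.exists_preimage w'
    exact ⟨t', by rw [ht', hw', hw]; rfl⟩
  choose φ hφ using h1
  refine ⟨⟨⟨φ, fun t t' => H.injective ?_⟩, fun f t => H.injective ?_⟩, hφ⟩
  · rw [map_add, hφ, hφ, hφ, map_add, mul_add]
  · rw [RingHom.id_apply, map_smul, hφ, hφ, map_smul]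
    rfl

lemma module_finite {n : ℕ} {i : Q →ₗ[R] (Fin n → X)} {p : (Fin n → X) →ₗ[R] Q}
    (h : p ∘ₗ i = LinearMap.id) : Module.Finite (Module.End R X)ᵐᵒᵖ T := by
  obtain ⟨q, hq⟩ := H.exists_projection
  have := homModule_finite h
  refine Module.Finite.of_surjective q fun t => ?_
  obtain ⟨g, hg⟩ := H.exists_factor t
  exact ⟨g, H.injective ((hq g).trans hg)⟩

/-- The endomorphism ring of `T` is the endomorphism ring of `X`. -/
lemma nonempty_end_ringEquiv (hπ : Function.Surjective π) [Module.Projective R Q] {n m : ℕ}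
    {i : Q →ₗ[R] (Fin n → X)} {p : (Fin n → X) →ₗ[R] Q} (h : p ∘ₗ i = LinearMap.id)
    {i' : LinearMap.ker π →ₗ[R] (Fin m → X)} {p' : (Fin m → X) →ₗ[R] LinearMap.ker π}
    (h' : p' ∘ₗ i' = LinearMap.id) :
    Nonempty (Module.End R X ≃+* Module.End (Module.End R X)ᵐᵒᵖ T) := by
  obtain ⟨q, hq⟩ := H.exists_projection
  have h1 : ∀ g : Module.End R X, ∃ φ : Module.End (Module.End R X)ᵐᵒᵖ T,
      ∀ t, ι (φ t) = g * ι t := fun g => H.exists_mul_eq g fun w => by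
    -- Projectivity of `Q` lifts `g ∘ π` through `π`, so left multiplication by `g` preserves the
    -- ideal.
    obtain ⟨a, ha⟩ := Module.projective_lifting_property π (g ∘ₗ π) hπ
    exact ⟨a ∘ₗ w, by rw [← LinearMap.comp_assoc, ha, LinearMap.comp_assoc]⟩
  choose Φ hΦ using h1
  let Ψ : Module.End R X →+* Module.End (Module.End R X)ᵐᵒᵖ T :=
    { toFun := Φ
      map_one' := LinearMap.ext fun t => H.injective (by rw [hΦ, one_mul]; rfl)
      map_zero' := LinearMap.ext fun t => H.injective (by
        rw [hΦ, zero_mul, LinearMap.zero_apply, map_zero])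
      map_mul' := fun g g' => LinearMap.ext fun t => H.injective (by
        rw [hΦ, Module.End.mul_apply, hΦ, hΦ, mul_assoc])
      map_add' := fun g g' => LinearMap.ext fun t => H.injective (by
        rw [hΦ, LinearMap.add_apply, map_add, hΦ, hΦ, add_mul]) }
  refine ⟨RingEquiv.ofBijective Ψ ⟨(injective_iff_map_eq_zero Ψ).2 fun g hg => ?_, fun φ => ?_⟩⟩
  -- If `g` annihilates `T`, then `g ∘ π` vanishes on all morphisms `X ⟶ Q`, hence on `Q`, which
  -- lies in `add X`; surjectivity of `π` then gives `g = 0`.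
  · have h2 : g ∘ₗ π = 0 := eq_zero_of_forall_comp h fun w => by
      have h3 := hΦ g (q w)
      have h4 : Φ g = 0 := hg
      rw [h4, LinearMap.zero_apply, map_zero, hq] at h3
      exact h3.symm
    ext x
    obtain ⟨y, rfl⟩ := hπ x
    exact LinearMap.congr_fun h2 y
  · obtain ⟨v, hv⟩ := H.exists_eq_comp h (φ ∘ₗ q)
    -- The composite `φ ∘ q` kills every morphism `X ⟶ ker π`. As `ker π` is in `add X`, it follows
    -- that `π ∘ v` vanishes on `ker π` and descends to an endomorphism of `X ≅ Q / ker π`.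
    have h2 : (π ∘ₗ v) ∘ₗ (LinearMap.ker π).subtype = 0 := eq_zero_of_forall_comp h' fun w => by
      have h3 := hv ((LinearMap.ker π).subtype ∘ₗ w)
      have h4 : q ((LinearMap.ker π).subtype ∘ₗ w) = 0 := H.injective (by
        rw [hq, map_zero]
        ext x
        exact (w x).2)
      refine h3.symm.trans ?_
      change ι (φ (q ((LinearMap.ker π).subtype ∘ₗ w))) = 0
      rw [h4, map_zero, map_zero]
    let e := π.quotKerEquivOfSurjective hπ
    let g : Module.End R X := (LinearMap.ker π).liftQ (π ∘ₗ v)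
      (fun x hx => LinearMap.congr_fun h2 ⟨x, hx⟩) ∘ₗ e.symm.toLinearMap
    have hg : ∀ y, g (π y) = π (v y) := fun y => by
      have h5 : e.symm (π y) = Submodule.Quotient.mk y := e.symm_apply_eq.2 rfl
      exact congrArg _ h5
    refine ⟨g, LinearMap.ext fun t => H.injective ?_⟩
    obtain ⟨w, hw⟩ := H.exists_factor t
    obtain rfl : q w = t := H.injective ((hq w).trans hw)
    refine (hΦ g (q w)).trans (Eq.trans ?_ (hv w).symm)
    rw [hq]
    ext x
    exact hg (w x)

end IsFactorIdeal

end TraceIdeal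

/-! ### Homological dimensions and rigidity of the ideal -/

section FactorIdealHomology

variable {R : Type u} [Ring R] {X Q : Type u} [AddCommGroup X] [Module R X]
  [AddCommGroup Q] [Module R Q] {T : ModuleCat.{u} (Module.End R X)ᵐᵒᵖ}
  {π : Q →ₗ[R] X} {ι : T →ₗ[(Module.End R X)ᵐᵒᵖ] Module.End R X}

/-- The map `Hom(X, M) ⟶ Hom(X, N)` induced by a morphism `M ⟶ N`. -/
def HomModule.map {M N : Type u} [AddCommGroup M] [Module R M] [AddCommGroup N] [Module R N]
    (f : M →ₗ[R] N) : HomModule R X M →ₗ[(Module.End R X)ᵐᵒᵖ] HomModule R X N where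
  toFun w := f ∘ₗ w
  map_add' w w' := LinearMap.comp_add w w' f
  map_smul' _ _ := rfl

namespace IsFactorIdeal

variable (H : IsFactorIdeal π ι)
include H

/-- The exact sequence `0 ⟶ Hom(X, ker π) ⟶ Hom(X, Q) ⟶ T ⟶ 0`. -/
lemma exists_shortExact : ∃ (q : HomModule R X Q →ₗ[(Module.End R X)ᵐᵒᵖ] T)
    (w : ModuleCat.ofHom (HomModule.map (X := X) (LinearMap.ker π).subtype) ≫
      ModuleCat.ofHom q = 0), (∀ g : X →ₗ[R] Q, ι (q g) = π ∘ₗ g) ∧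
      (ShortComplex.mk _ _ w).ShortExact := by
  obtain ⟨q, hq⟩ := H.exists_projection
  have h0 : ∀ w : X →ₗ[R] LinearMap.ker π, q (HomModule.map (LinearMap.ker π).subtype w) = 0 :=
    fun w => H.injective (by
      refine (hq _).trans (Eq.trans ?_ (map_zero ι).symm)
      ext x
      exact (w x).2)
  refine ⟨q, by ext w; exact h0 w, hq, ?_⟩
  refine { exact := ?_, mono_f := ?_, epi_g := ?_ }
  · refine (ShortComplex.ShortExact.moduleCat_exact_iff_function_exact _).2
      fun (g : X →ₗ[R] Q) => ⟨fun (hg : q g = 0) => ?_, ?_⟩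
    · have h1 : π ∘ₗ g = 0 := by rw [← hq, hg, map_zero]
      exact ⟨LinearMap.codRestrict (LinearMap.ker π) g (LinearMap.congr_fun h1), rfl⟩
    · rintro ⟨w, rfl⟩
      exact h0 w
  · refine (ModuleCat.mono_iff_injective _).2 fun (w w' : X →ₗ[R] LinearMap.ker π) h => ?_
    apply LinearMap.ext
    intro x
    exact Subtype.ext (LinearMap.congr_fun (h : (LinearMap.ker π).subtype ∘ₗ w =
      (LinearMap.ker π).subtype ∘ₗ w') x)
  · refine (ModuleCat.epi_iff_surjective _).2 fun t => ?_
    obtain ⟨g, hg⟩ := H.exists_factor t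
    exact ⟨g, H.injective ((hq g).trans hg)⟩

/-- The sequence `0 ⟶ Hom(X, ker π) ⟶ Hom(X, Q) ⟶ T ⟶ 0` is a projective resolution. Rigidity
reduces to `hext`, and the count to the identification of the endomorphism ring. -/
lemma isTilting (hπ : Function.Surjective π) [Module.Projective R Q] {n m : ℕ}
    {i : Q →ₗ[R] (Fin n → X)} {p : (Fin n → X) →ₗ[R] Q} (h : p ∘ₗ i = LinearMap.id)
    {i' : LinearMap.ker π →ₗ[R] (Fin m → X)} {p' : (Fin m → X) →ₗ[R] LinearMap.ker π}
    (h' : p' ∘ₗ i' = LinearMap.id)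
    (hext : ∀ v : LinearMap.ker π →ₗ[R] Q, ∃ v' : Q →ₗ[R] Q, v' ∘ₗ (LinearMap.ker π).subtype = v) :
    IsTilting (Module.End R X)ᵐᵒᵖ T := by
  obtain ⟨q, w, hq, hS⟩ := H.exists_shortExact
  have := homModule_projective h
  have := homModule_projective h'
  have hp₂ : Projective (ModuleCat.of (Module.End R X)ᵐᵒᵖ (HomModule R X Q)) := inferInstance
  have hp₁ : Projective (ModuleCat.of (Module.End R X)ᵐᵒᵖ (HomModule R X (LinearMap.ker π))) :=
    inferInstance
  refine ⟨H.module_finite h, ?_, ?_, ?_⟩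
  · have h₁ : HasProjectiveDimensionLT
        (ModuleCat.of (Module.End R X)ᵐᵒᵖ (HomModule R X (LinearMap.ker π))) 1 := inferInstance
    exact (hS.hasProjectiveDimensionLT_X₃_iff 0 hp₂).2 h₁
  · refine @subsingleton_ext_one_of_extend _ _ _ _ _ hS hp₂ _ fun f => ?_
    obtain ⟨v, hv⟩ := H.exists_eq_comp h' f.hom
    obtain ⟨v', hv'⟩ := hext v
    -- The given map is composition with `π ∘ v`, so composition with `π ∘ v'` extends it to `Hom(X,
    -- Q)`.
    refine ⟨ModuleCat.ofHom (q ∘ₗ HomModule.map v'), ?_⟩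
    apply ModuleCat.hom_ext
    apply LinearMap.ext
    intro (w : X →ₗ[R] LinearMap.ker π)
    apply H.injective
    refine (hq _).trans (Eq.trans ?_ (hv w).symm)
    rw [← hv']
    rfl
  · obtain ⟨e⟩ := H.nonempty_end_ringEquiv hπ h h'
    exact numIndecSummands_eq_of_ringEquiv
      -- The endomorphism ring of the regular left module is the opposite ring, here the double
      -- opposite of `End(X)`.
      (e.symm.trans ((RingEquiv.opOp _).trans (RingEquiv.moduleEndSelf (Module.End R X)ᵐᵒᵖ)))

/-- The lifting property behind the bound on the injective dimension of `T`. -/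
lemma exists_extend {E C : Type u} [AddCommGroup E] [Module (Module.End R X)ᵐᵒᵖ E]
    [AddCommGroup C] [Module (Module.End R X)ᵐᵒᵖ C] [Module.Injective (Module.End R X)ᵐᵒᵖ E]
    {j : T →ₗ[(Module.End R X)ᵐᵒᵖ] E} {c : E →ₗ[(Module.End R X)ᵐᵒᵖ] C}
    (hj : Function.Injective j) (hjc : Function.Exact j c) (hc : Function.Surjective c)
    {n : ℕ} (s : Fin n → (Module.End R X)ᵐᵒᵖ) {I : Ideal (Module.End R X)ᵐᵒᵖ}
    (hI : Ideal.span (Set.range s) = I) {d : (Fin n → X) →ₗ[R] X}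
    (hd : ∀ x, d x = ∑ k, (s k).unop (x k)) {m : ℕ}
    {i : LinearMap.ker d →ₗ[R] (Fin m → X)} {p : (Fin m → X) →ₗ[R] LinearMap.ker d}
    (h : p ∘ₗ i = LinearMap.id)
    (hext : ∀ v : LinearMap.ker d →ₗ[R] Q, ∃ v' : (Fin n → X) →ₗ[R] Q,
      v' ∘ₗ (LinearMap.ker d).subtype = v)
    (f : I →ₗ[(Module.End R X)ᵐᵒᵖ] C) :
    ∃ f' : (Module.End R X)ᵐᵒᵖ →ₗ[(Module.End R X)ᵐᵒᵖ] C, ∀ x (hx : x ∈ I), f' x = f ⟨x, hx⟩ := by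
  let a₀ : (Fin n → (Module.End R X)ᵐᵒᵖ) →ₗ[(Module.End R X)ᵐᵒᵖ] (Module.End R X)ᵐᵒᵖ :=
    Fintype.linearCombination _ s
  have ha₀ : LinearMap.range a₀ = I := by
    rw [← hI]
    exact Fintype.range_linearCombination _ s
  have hmem : ∀ b, a₀ b ∈ I := fun b => ha₀ ▸ LinearMap.mem_range_self a₀ b
  let a : (Fin n → (Module.End R X)ᵐᵒᵖ) →ₗ[(Module.End R X)ᵐᵒᵖ] I := a₀.codRestrict I hmem
  have ha : Function.Surjective a := fun ⟨x, hx⟩ => by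
    rw [← ha₀] at hx
    obtain ⟨b, rfl⟩ := hx
    exact ⟨b, rfl⟩
  -- Under the identification of the free module with `Hom(X, Xⁿ)`, the map `a₀` is composition with
  -- `d`. Hence the kernel of `a` is `Hom(X, ker d)`, embedded by `r` below.
  have haeq : ∀ (b : Fin n → (Module.End R X)ᵐᵒᵖ) (x : X),
      (a₀ b).unop x = d (fun k => (b k).unop x) := fun b x => by
    rw [hd, Fintype.linearCombination_apply, Finset.unop_sum, LinearMap.sum_apply]
    rfl
  obtain ⟨g, hg⟩ := Module.projective_lifting_property c (f ∘ₗ a) hc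
  have hg' : ∀ b, c (g b) = f (a b) := LinearMap.congr_fun hg
  let r : HomModule R X (LinearMap.ker d) →ₗ[(Module.End R X)ᵐᵒᵖ]
      (Fin n → (Module.End R X)ᵐᵒᵖ) := homModuleToFree (LinearMap.ker d).subtype
  have hr : ∀ w, a (r w) = 0 := fun (w : X →ₗ[R] LinearMap.ker d) => by
    apply Subtype.ext
    apply MulOpposite.unop_injective
    apply LinearMap.ext
    intro x
    exact (haeq _ x).trans (w x).2
  -- The lift `g` need not vanish on the relations, but its values there die in `C`; it therefore
  -- restricts to a map `φ : Hom(X, ker d) ⟶ T`.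
  have ht : ∀ w, g (r w) ∈ LinearMap.range j := fun w =>
    (hjc _).1 (by rw [hg', hr, map_zero])
  let φ : HomModule R X (LinearMap.ker d) →ₗ[(Module.End R X)ᵐᵒᵖ] T :=
    (LinearEquiv.ofInjective j hj).symm.toLinearMap ∘ₗ (g ∘ₗ r).codRestrict _ ht
  have hφ : ∀ w, j (φ w) = g (r w) := fun w =>
    congrArg Subtype.val ((LinearEquiv.ofInjective j hj).apply_symm_apply ⟨g (r w), ht w⟩)
  obtain ⟨v, hv⟩ := H.exists_eq_comp h φ
  obtain ⟨v', hv'⟩ := hext v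
  obtain ⟨q, hq⟩ := H.exists_projection
  -- An extension of `φ` to the whole free module, obtained from the extension `v'` of `v` to `Xⁿ`.
  let h' : (Fin n → (Module.End R X)ᵐᵒᵖ) →ₗ[(Module.End R X)ᵐᵒᵖ] T := q ∘ₗ homModuleOfFree v'
  have hh' : ∀ w, h' (r w) = φ w := fun (w : X →ₗ[R] LinearMap.ker d) => by
    apply H.injective
    refine (hq _).trans (Eq.trans ?_ (hv w).symm)
    rw [← hv']
    rfl
  -- Subtracting `j ∘ h'` makes the lift vanish on the relations without changing its image in `C`,
  -- so it descends to a lift `l : I ⟶ E` of `f`; injectivity of `E` then extends `l` to the whole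
  -- ring.
  have hker : LinearMap.ker a ≤ LinearMap.ker (g - j ∘ₗ h') := by
    intro b hb
    have hb' : ∀ x, (fun k => (b k).unop x) ∈ LinearMap.ker d := fun x => by
      have h1 : a₀ b = 0 := congrArg Subtype.val hb
      rw [LinearMap.mem_ker, ← haeq, h1]
      rfl
    obtain ⟨w, rfl⟩ : ∃ w, r w = b :=
      ⟨LinearMap.codRestrict (LinearMap.ker d) (LinearMap.pi fun k => (b k).unop) hb', rfl⟩
    rw [LinearMap.mem_ker, LinearMap.sub_apply, LinearMap.comp_apply, hh', hφ, sub_self]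
  let l : I →ₗ[(Module.End R X)ᵐᵒᵖ] E := (LinearMap.ker a).liftQ (g - j ∘ₗ h') hker ∘ₗ
    (a.quotKerEquivOfSurjective ha).symm.toLinearMap
  have hl : ∀ b, l (a b) = g b - j (h' b) := fun b => by
    have h5 : (a.quotKerEquivOfSurjective ha).symm (a b) = Submodule.Quotient.mk b :=
      (LinearEquiv.symm_apply_eq _).2 rfl
    exact congrArg _ h5
  obtain ⟨l', hl'⟩ := Module.Injective.extension_property (Module.End R X)ᵐᵒᵖ E _ _
    I.subtype I.injective_subtype l
  refine ⟨c ∘ₗ l', fun x hx => ?_⟩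
  obtain ⟨b, hb⟩ := ha ⟨x, hx⟩
  have h6 : l' x = l ⟨x, hx⟩ := LinearMap.congr_fun hl' ⟨x, hx⟩
  rw [LinearMap.comp_apply, h6, ← hb, hl, map_sub, hg', (hjc _).2 ⟨_, rfl⟩, sub_zero]

/-- The cokernel of an embedding of `T` into an injective is itself injective by Baer's criterion.
The noetherian hypothesis makes every ideal finitely generated, so that its generators assemble into
a morphism `Xⁿ ⟶ X`. -/
lemma hasInjectiveDimensionLE [IsNoetherianRing (Module.End R X)ᵐᵒᵖ]
    (hadd : ∀ (n : ℕ) (d : (Fin n → X) →ₗ[R] X), ∃ (m : ℕ)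
      (i : LinearMap.ker d →ₗ[R] (Fin m → X)) (p : (Fin m → X) →ₗ[R] LinearMap.ker d),
      p ∘ₗ i = LinearMap.id)
    (hext : ∀ (n : ℕ) (d : (Fin n → X) →ₗ[R] X) (v : LinearMap.ker d →ₗ[R] Q),
      ∃ v' : (Fin n → X) →ₗ[R] Q, v' ∘ₗ (LinearMap.ker d).subtype = v) :
    HasInjectiveDimensionLE T 1 := by
  let E : ModuleCat.{u} (Module.End R X)ᵐᵒᵖ := Injective.under T
  let j : T ⟶ E := Injective.ι T
  have hE : Injective (ModuleCat.of (Module.End R X)ᵐᵒᵖ E) := inferInstanceAs (Injective E)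
  have hE' : Module.Injective (Module.End R X)ᵐᵒᵖ E :=
    Module.injective_module_of_injective_object _ _
  have hj : Function.Injective j.hom := (ModuleCat.mono_iff_injective j).1 inferInstance
  let K : Submodule (Module.End R X)ᵐᵒᵖ E := LinearMap.range j.hom
  have hex : Function.Exact j.hom K.mkQ := LinearMap.exact_map_mkQ_range j.hom
  have hS : (ShortComplex.mk j (ModuleCat.ofHom K.mkQ)
      (by ext x; exact hex.apply_apply_eq_zero x)).ShortExact :=
    { exact := (ShortComplex.ShortExact.moduleCat_exact_iff_function_exact _).2 hex
      mono_f := inferInstanceAs (Mono j)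
      epi_g := (ModuleCat.epi_iff_surjective _).2 K.mkQ_surjective }
  have hB : Module.Baer (Module.End R X)ᵐᵒᵖ (E ⧸ K) := fun I f => by
    obtain ⟨n, s, hs⟩ := Submodule.fg_iff_exists_fin_generating_family.1
      (IsNoetherian.noetherian I)
    let d : (Fin n → X) →ₗ[R] X := ∑ k, (s k).unop ∘ₗ LinearMap.proj k
    obtain ⟨m, i, p, h⟩ := hadd n d
    exact H.exists_extend hj hex K.mkQ_surjective s hs (d := d)
      (fun x => by simp [d, LinearMap.sum_apply]) h (hext n d) f
  have := hB.injective
  have hC : Injective (ModuleCat.of (Module.End R X)ᵐᵒᵖ (E ⧸ K)) :=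
    Module.injective_object_of_injective_module _ _
  have h₁ : HasInjectiveDimensionLT (ModuleCat.of (Module.End R X)ᵐᵒᵖ (E ⧸ K)) 1 := inferInstance
  exact (hS.hasInjectiveDimensionLT_X₃_iff 0 (inferInstanceAs (Injective E))).1 h₁

end IsFactorIdeal

end FactorIdealHomology

/-! ### The intermediate extension as a subfunctor of `Hom(-, M)` -/

section IntermediateExtension

variable {C : Type u} [Category.{v} C] [Abelian C] (𝒳 : ObjectProperty C)

lemma nonempty_fullSubcategory [𝒳.IsClosedUnderFiniteProducts] : Nonempty 𝒳.FullSubcategory :=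
  ⟨⟨_, 𝒳.prop_of_isTerminal _ terminalIsTerminal⟩⟩

variable {𝒳} in
-- The inclusion of `mod-𝒳` into all functors preserves monomorphisms, and these are pointwise in
-- the functor category. This and its dual allow the image of `γ` to be computed object by object.
lemma app_injective_of_mono [ContravariantlyFinite 𝒳] [𝒳.IsClosedUnderFiniteProducts]
    {F G : ModCat 𝒳} (α : F ⟶ G) [Mono α] (Y : 𝒳.FullSubcategoryᵒᵖ) :
    Function.Injective (α.hom.app Y) := by
  have := nonempty_fullSubcategory 𝒳
  have := (finitelyPresented 𝒳.FullSubcategory).preservesMonomorphisms_ι_of_isNormalEpiCategory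
  have h : Mono ((finitelyPresented _).ι.map α) := inferInstance
  exact (AddCommGrpCat.mono_iff_injective _).1 ((NatTrans.mono_iff_mono_app _).1 h Y)

variable {𝒳} in
lemma app_surjective_of_epi [ContravariantlyFinite 𝒳] [𝒳.IsClosedUnderFiniteProducts]
    {F G : ModCat 𝒳} (α : F ⟶ G) [Epi α] (Y : 𝒳.FullSubcategoryᵒᵖ) :
    Function.Surjective (α.hom.app Y) := by
  have := nonempty_fullSubcategory 𝒳
  have := hasBinaryBiproducts_fullSubcategory 𝒳
  have := (finitelyPresented 𝒳.FullSubcategory).preservesEpimorphisms_ι_of_isNormalMonoCategory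
  have h : Epi ((finitelyPresented _).ι.map α) := inferInstance
  exact (AddCommGrpCat.epi_iff_surjective _).1 ((NatTrans.epi_iff_epi_app _).1 h Y)

variable [EnoughProjectives C] [ContainsProjectives 𝒳] [ContravariantlyFinite 𝒳]
  [𝒳.IsClosedUnderFiniteProducts] (G : 𝒳.FullSubcategory) [Projective G.obj]
  (hG : IsSeparator G.obj)

/-- `γ` sends the generator of `ϑ_λ M` to the projection `Q ⟶ M` of the projective cover. -/
lemma genValueL_gamma (M : C) :
    genValueL (𝒳 := 𝒳) ((relRecollement 𝒳 G hG).γ.app M) = Projective.π M := by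
  let R := relRecollement 𝒳 G hG
  let y : (cover₀ 𝒳 M).obj ⟶ M := genValueL (𝒳 := 𝒳) (R.γ.app M)
  -- By definition, the adjunct of `γ` is the inverse of the counit; only the hom-set bijection has
  -- to be made explicit.
  have h1 : thetaLHomEquiv (𝒳 := 𝒳) M ((thetaR 𝒳).obj M) (R.γ.app M) =
      inv ((thetaAdjR 𝒳).counit.app M) := by
    have h := (R.ϑlAdj.homEquiv M (R.ϑr.obj M)).apply_symm_apply (inv (R.ϑrAdj.counit.app M))
    refine Eq.trans ?_ h
    have h0 : (thetaAdjL 𝒳).homEquiv = thetaLHomEquiv := Adjunction.mkOfHomEquiv_homEquiv _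
    rw [← h0]
    rfl
  have h2 : Projective.π M ≫ inv ((thetaAdjR 𝒳).counit.app M) =
      evalEquiv ((thetaR 𝒳).obj M) (cover₀ 𝒳 M) y := by
    rw [← h1]
    exact Abelian.comp_epiDesc _ _ _
  -- `evalEquiv` is the unit of `ϑ ⊣ ϑ_ρ` at an object, so composing with the counit returns `y` by
  -- the triangle identity. The counit then cancels against its inverse in `h2`.
  have h3 : (evalEquiv ((thetaR 𝒳).obj M) (cover₀ 𝒳 M) y : (cover₀ 𝒳 M).obj ⟶ _) ≫
      (thetaAdjR 𝒳).counit.app M = y :=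
    congrArg (fun β => β.hom.app (op (cover₀ 𝒳 M)) y)
      ((thetaAdjR 𝒳).right_triangle_components M)
  rw [← h2, Category.assoc, IsIso.inv_hom_id, Category.comp_id] at h3
  exact h3.symm

lemma gamma_app_val (M : C) {Y : 𝒳.FullSubcategory} (g : Y ⟶ cover₀ 𝒳 M) :
    ((relRecollement 𝒳 G hG).γ.app M).hom.app (op Y) ((thetaLPres 𝒳 M).val g) =
      (g.hom ≫ Projective.π M : Y.obj ⟶ M) := by
  have h1 := ((thetaLPres 𝒳 M).map_val g (𝟙 (cover₀ 𝒳 M))).trans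
    (congrArg (thetaLPres 𝒳 M).val (Category.comp_id g))
  rw [← h1]
  refine (naturality_apply ((relRecollement 𝒳 G hG).γ.app M).hom g.op _).trans ?_
  exact congrArg (fun t : (cover₀ 𝒳 M).obj ⟶ M => g.hom ≫ t) (genValueL_gamma 𝒳 G hG M)

/-- The inclusion `ζ M ⟶ Hom(-, M)`. -/
noncomputable def zetaι (M : C) : (relRecollement 𝒳 G hG).ζ.obj M ⟶ (thetaR 𝒳).obj M :=
  image.ι ((relRecollement 𝒳 G hG).γ.app M)

lemma zetaι_injective (M : C) (Y : 𝒳.FullSubcategoryᵒᵖ) :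
    Function.Injective ((zetaι 𝒳 G hG M).hom.app Y) :=
  have : Mono (zetaι 𝒳 G hG M) :=
    inferInstanceAs (Mono (image.ι ((relRecollement 𝒳 G hG).γ.app M)))
  app_injective_of_mono _ Y

/-- The image of `ζ M ⟶ Hom(-, M)` consists of the morphisms that factor through the projective
cover of `M`. -/
lemma exists_zetaι_eq_iff (M : C) (Y : 𝒳.FullSubcategory) (f : Y.obj ⟶ M) :
    (∃ t, (zetaι 𝒳 G hG M).hom.app (op Y) t = f) ↔
      ∃ g : Y.obj ⟶ Projective.over M, g ≫ Projective.π M = f := by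
  let e := factorThruImage ((relRecollement 𝒳 G hG).γ.app M)
  have he : ∀ x, (zetaι 𝒳 G hG M).hom.app (op Y) (e.hom.app (op Y) x) =
      ((relRecollement 𝒳 G hG).γ.app M).hom.app (op Y) x := fun x =>
    congrArg (fun β => β.hom.app (op Y) x) (image.fac ((relRecollement 𝒳 G hG).γ.app M))
  constructor
  · rintro ⟨t, rfl⟩
    -- The map from `ϑ_λ M` onto the image is pointwise surjective, and elements of `ϑ_λ M` at `Y`
    -- are represented by morphisms from `Y` to the projective.
    obtain ⟨x, rfl⟩ := app_surjective_of_epi e (op Y) t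
    obtain ⟨g, rfl⟩ := (thetaLPres 𝒳 M).exists_val x
    exact ⟨g.hom, ((he _).trans (gamma_app_val 𝒳 G hG M g)).symm⟩
  · rintro ⟨g, rfl⟩
    exact ⟨e.hom.app (op Y) ((thetaLPres 𝒳 M).val (ObjectProperty.homMk g)),
      (he _).trans (gamma_app_val 𝒳 G hG M _)⟩

end IntermediateExtension

/-! ### Finitely generated modules, syzygies and the noetherian property -/

section AddClosure

variable {R : Type u} [Ring R]

lemma module_projective_of_projective [IsNoetherianRing R] (P : FGModuleCat.{u} R) [Projective P] :
    Module.Projective R P := by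
  obtain ⟨n, f, hf⟩ := Module.Finite.exists_fin' R P
  have he : Epi (FGModuleCat.ofHom f) := ConcreteCategory.epi_of_surjective _ hf
  refine Module.Projective.of_split
    (Projective.factorThru (𝟙 P) (FGModuleCat.ofHom f)).hom.hom f ?_
  exact congrArg (fun t => t.hom.hom) (Projective.factorThru_comp (𝟙 P) (FGModuleCat.ofHom f))

lemma mono_ofHom_of_injective {M N : Type u} [AddCommGroup M] [Module R M] [Module.Finite R M]
    [AddCommGroup N] [Module R N] [Module.Finite R N] {f : M →ₗ[R] N}
    (hf : Function.Injective f) : Mono (FGModuleCat.ofHom f) :=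
  ConcreteCategory.mono_of_injective _ hf

lemma addClosure_of_linearEquiv {X : FGModuleCat.{u} R} {M : Type u} [AddCommGroup M] [Module R M]
    [Module.Finite R M] (e : M ≃ₗ[R] X) : addClosure X (FGModuleCat.of R M) :=
  addClosure_of_finite (ι := Unit) (LinearMap.pi fun _ => e.toLinearMap)
    (e.symm.toLinearMap ∘ₗ LinearMap.proj ()) (by ext x; exact e.symm_apply_apply x)

/-- The kernel of an epimorphism from a projective module onto a module in `𝒳`. -/
lemma ClosedUnderSyzygies.prop_ker [IsNoetherianRing R] {𝒳 : ObjectProperty (FGModuleCat.{u} R)}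
    (h𝒳 : ClosedUnderSyzygies 𝒳) {P M : FGModuleCat.{u} R} [Projective P] (π : P ⟶ M) [Epi π]
    (hM : 𝒳 M) : 𝒳 (FGModuleCat.of R (LinearMap.ker π.hom.hom)) := by
  let f : FGModuleCat.of R (LinearMap.ker π.hom.hom) ⟶ P :=
    FGModuleCat.ofHom (LinearMap.ker π.hom.hom).subtype
  have hf : Mono f := mono_ofHom_of_injective (Submodule.injective_subtype _)
  have w : f ≫ π = 0 := by
    apply FGModuleCat.hom_ext
    ext x
    exact x.2
  have hex : (ShortComplex.mk f π w).Exact := by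
    apply ShortComplex.exact_of_f_is_kernel
    refine KernelFork.IsLimit.ofι' f w fun {A} k hk => ⟨FGModuleCat.ofHom
      (LinearMap.codRestrict _ k.hom.hom fun x =>
        LinearMap.congr_fun (congrArg (fun t : A ⟶ M => t.hom.hom) hk) x), ?_⟩
    apply FGModuleCat.hom_ext
    rfl
  exact h𝒳 (ShortComplex.mk f π w) { exact := hex, mono_f := hf, epi_g := inferInstance }
    inferInstance hM

/-- Morphisms from a submodule `K` of `Y` to a projective module extend to `Y` if the quotient
`Y ⧸ K` is in `⊥R`. -/
lemma exists_extend_of_leftPerp {Y : Type u} [AddCommGroup Y] [Module R Y] [Module.Finite R Y]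
    (K : Submodule R Y) (hK : leftPerp R (FGModuleCat.of R (Y ⧸ K))) {Q : Type u} [AddCommGroup Q]
    [Module R Q] [Module.Finite R Q] [Module.Projective R Q] (v : K →ₗ[R] Q) :
    ∃ v' : Y →ₗ[R] Q, v' ∘ₗ K.subtype = v :=
  exists_extend_to_projective K (hK 1 one_pos) v

/-- Restricting scalars embeds the endomorphism ring into the `k`-linear endomorphisms of `X`, a
finite module over the noetherian ring `k`. -/
lemma isNoetherianRing_end_mulOpposite (k : Type w) [CommRing k] [IsNoetherianRing k] [Algebra k R]
    [Module.Finite k R] (X : Type u) [AddCommGroup X] [Module R X] [Module.Finite R X] :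
    IsNoetherianRing (Module.End R X)ᵐᵒᵖ := by
  let _ : Module k X := Module.compHom X (algebraMap k R)
  have : IsScalarTower k R X := IsScalarTower.of_algebraMap_smul fun _ _ => rfl
  have : SMulCommClass R k X := ⟨fun r c x => by
    rw [← algebraMap_smul R c x, ← algebraMap_smul R c (r • x), smul_smul, smul_smul,
      Algebra.commutes]⟩
  have : SMulCommClass k R X := SMulCommClass.symm _ _ _
  have : Module.Finite k X := Module.Finite.trans R X
  have : Module.Finite k (Module.End k X) := inferInstance
  let j : Module.End R X →ₗ[k] Module.End k X :=
    { toFun := fun f => f.restrictScalars k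
      map_add' := fun _ _ => rfl
      map_smul' := fun _ _ => rfl }
  have hj : Function.Injective j := LinearMap.restrictScalars_injective k
  have : IsNoetherian k (Module.End R X) := isNoetherian_of_injective j hj
  have : Module.Finite k (Module.End R X)ᵐᵒᵖ := inferInstance
  exact IsNoetherianRing.of_finite k _

end AddClosure

/-! ### Application to the module `ζ_X(X)` -/

section ZetaModule

variable {R : Type u} [Ring R] [IsNoetherianRing R] (X : FGModuleCat.{u} R)
  [ContravariantlyFinite (addClosure X)] [ContainsProjectives (addClosure X)]

/-- The inclusion of `ζ_X(X)` into `End(X)`. -/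
noncomputable def zetaModuleι : zetaModule X →ₗ[(Aus X)ᵐᵒᵖ] Aus X where
  toFun t := (show X ⟶ X from (zetaι (addClosure X) (regular _) isSeparator_regular X).hom.app
    (op ⟨X, addClosure_self X⟩) t).hom.hom
  map_add' t t' := congrArg (fun f : X ⟶ X => f.hom.hom)
    (((zetaι (addClosure X) (regular _) isSeparator_regular X).hom.app
      (op ⟨X, addClosure_self X⟩)).hom.map_add t t')
  map_smul' f t := congrArg (fun f : X ⟶ X => f.hom.hom)
    (naturality_apply (zetaι (addClosure X) (regular _) isSeparator_regular X).hom
      (endHom (X := (⟨X, addClosure_self X⟩ : (addClosure X).FullSubcategory)) f.unop).op t)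

/-- This is the pointwise description of the intermediate extension of `X`, evaluated at `X` itself;
it is the bridge from functors to `End(X)`-modules. -/
lemma isFactorIdeal_zetaModuleι :
    IsFactorIdeal (Projective.π X).hom.hom (zetaModuleι X) where
  injective t t' h := zetaι_injective (addClosure X) (regular _) isSeparator_regular X _
    (FGModuleCat.hom_ext h : (_ : X ⟶ X) = _)
  exists_factor t := by
    obtain ⟨g, hg⟩ := (exists_zetaι_eq_iff (addClosure X) (regular _) isSeparator_regular X
      ⟨X, addClosure_self X⟩ _).1 ⟨t, rfl⟩
    exact ⟨g.hom.hom, congrArg (fun f : X ⟶ X => f.hom.hom) hg⟩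
  exists_preimage g := by
    obtain ⟨t, ht⟩ := (exists_zetaι_eq_iff (addClosure X) (regular _) isSeparator_regular X
      ⟨X, addClosure_self X⟩ _).2 ⟨FGModuleCat.ofHom g, rfl⟩
    exact ⟨t, congrArg (fun f : X ⟶ X => f.hom.hom) ht⟩

variable {X}

/-- Closure under syzygies supplies `ker π` in `add X`; extension from `ker π` to `Q` holds because
`Q / ker π ≅ X` lies in `⊥R`. -/
lemma isTilting_zetaModule (hperp : addClosure X ≤ leftPerp R)
    (hsyz : ClosedUnderSyzygies (addClosure X)) : IsTilting (Aus X)ᵐᵒᵖ (zetaModule X) := by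
  have := module_projective_of_projective (Projective.over X)
  have hπ : Function.Surjective (Projective.π X).hom.hom :=
    FGModuleCat_surjective_of_epi (Projective.π X)
  obtain ⟨n, i, p, h⟩ := ContainsProjectives.prop_of_projective (𝒳 := addClosure X)
    (Projective.over X) inferInstance
  obtain ⟨m, i', p', h'⟩ := hsyz.prop_ker (Projective.π X) (addClosure_self X)
  exact (isFactorIdeal_zetaModuleι X).isTilting hπ h h' (exists_extend_of_leftPerp _
    (hperp _ (addClosure_of_linearEquiv ((Projective.π X).hom.hom.quotKerEquivOfSurjective hπ))))

/-- For `d : Xⁿ ⟶ X`, both `ker d ⊆ Xⁿ` and `Xⁿ / ker d`, which embeds in `X`, lie in `add X`. The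
first gives the splitting data, the second the vanishing needed to extend maps. -/
lemma hasInjectiveDimensionLE_zetaModule [IsNoetherianRing (Aus X)ᵐᵒᵖ]
    (hperp : addClosure X ≤ leftPerp R) [(addClosure X).IsClosedUnderSubobjects] :
    HasInjectiveDimensionLE (zetaModule X) 1 := by
  have := module_projective_of_projective (Projective.over X)
  refine (isFactorIdeal_zetaModuleι X).hasInjectiveDimensionLE (fun n d => ?_)
    (fun n d => exists_extend_of_leftPerp _ (hperp _ ?_))
  · have := mono_ofHom_of_injective (LinearMap.ker d).injective_subtype
    exact (addClosure X).prop_of_mono (FGModuleCat.ofHom (LinearMap.ker d).subtype)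
      (show addClosure X (FGModuleCat.of R (Fin n → X)) from
        ⟨n, LinearMap.id, LinearMap.id, rfl⟩)
  · have hinj : Function.Injective ((LinearMap.ker d).liftQ d le_rfl) :=
      LinearMap.ker_eq_bot.1 (Submodule.ker_liftQ_eq_bot _ _ _ le_rfl)
    have := mono_ofHom_of_injective hinj
    exact (addClosure X).prop_of_mono (FGModuleCat.ofHom ((LinearMap.ker d).liftQ d le_rfl))
      (addClosure_self X)

end ZetaModule

end RelAus

theorem mainTheorem1 {k : Type w} [CommRing k] [IsArtinianRing k]
    {Λ : Type u} [Ring Λ] [Algebra k Λ] [Module.Finite k Λ]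
    (X : FGModuleCat.{u} Λᵐᵒᵖ)
    [RelAus.ContravariantlyFinite (RelAus.addClosure X)]
    [RelAus.ContainsProjectives (RelAus.addClosure X)]
    (hperp : RelAus.addClosure X ≤ RelAus.leftPerp Λᵐᵒᵖ)
    (hsyz : RelAus.ClosedUnderSyzygies (RelAus.addClosure X)) :
    haveI : IsNoetherianRing Λᵐᵒᵖ := RelAus.isNoetherianRing_mulOpposite k Λ
    RelAus.IsTilting (RelAus.Aus X)ᵐᵒᵖ (RelAus.zetaModule X) ∧
      ((RelAus.addClosure X).IsClosedUnderSubobjects →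
        RelAus.IsCotilting (RelAus.Aus X)ᵐᵒᵖ (RelAus.zetaModule X)) := by
  have : IsNoetherianRing Λᵐᵒᵖ := RelAus.isNoetherianRing_mulOpposite k Λ
  have h := RelAus.isTilting_zetaModule hperp hsyz
  refine ⟨h, fun _ => ?_⟩
  have : IsNoetherianRing (RelAus.Aus X)ᵐᵒᵖ := RelAus.isNoetherianRing_end_mulOpposite k X
  -- Apart from the bound on the injective dimension, the cotilting conditions coincide with tilting
  -- ones.
  exact ⟨h.finite, RelAus.hasInjectiveDimensionLE_zetaModule hperp, h.rigid, h.card_summands⟩
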